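/- **Setting.** Let $\mathbb D=\{z\in\mathbb C:|z|<1\}$, let $\mathsf m$ be the normalised arc length measure on $\partial\mathbb D$, and let $\rho(z,w)=\log\frac{|1-z\bar w|+|z-w|}{|1-z\bar w|-|z-w|}$ be the hyperbolic distance on $\mathbb D$. Let $\mathfrak L=\frac{(1-|z|^2)^2}{4}(\partial_x^2+\partial_y^2)$ be the hyperbolic Laplacian. A function $f:\mathbb D\to\mathbb C$ is *$\lambda$-polyharmonic of order $m$* if it is of class $C^{2m}$ and $(\mathfrak L-\lambda I)^m f=0$ on $\mathbb D$. For $\lambda\in\mathbb C$ put $s=\sqrt{\lambda+\frac14}$ (principal branch). Let $P(z,\xi)=\frac{1-|z|^2}{|\xi-z|^2}$ and $\mathfrak h(z,\xi)=-\log P(z,\xi)$ for $z\in\mathbb D$, $\xi\in\partial\mathbb D$, and for integers $k\ge 0$ let $$P_k(z,\xi\,|\,\lambda)=\frac{(-\mathfrak h(z,\xi))^k}{k!\,(2s)^k}\,P(z,\xi)^{s+1/2}\quad(\lambda\ne-\tfrac14),\qquad P_k(z,\xi\,|-\tfrac14)=\frac{\mathfrak h(z,\xi)^{2k}}{(2k)!}\,P(z,\xi)^{1/2},$$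 $$\Phi_k(z\,|\,\lambda)=\int_{\partial\mathbb D}P_k(z,\xi\,|\,\lambda)\,d\mathsf m(\xi).$$ Let $\mathcal H(\partial\mathbb D)$ be the space of functions on $\partial\mathbb D$ that extend holomorphically to some annulus $\{1-\delta<|w|<1+\delta\}$, $\delta>0$, with the inductive limit topology. An *analytic functional* is a continuous linear functional $\nu$ on $\mathcal H(\partial\mathbb D)$, and one writes $\int g\,d\nu=\nu(g)$. A $\lambda$-polyharmonic function $f$ of order $n+1$ is called *regular* if in its representation $$f(z)=\sum_{k=0}^{n}\int_{\partial\mathbb D}P_k(z,\xi\,|\,\lambda)\,d\nu_k(\xi),\qquad z\in\mathbb D,\tag{1}$$ by analytic functionals $\nu_0,\dots,\nu_n$, all the $\nu_k$ are complex Borel measures on $\partial\mathbb D$. For $\xi\in\partial\mathbb D$ and $a\ge0$ let $[0,\xi]$ be the radius ending at $\xi$, and $$\Gamma_a(\xi)=\{z\in\mathbb D:\rho(z,[0,\xi])\le a\},\qquad \Gamma_{(a)}(\xi)=\{z\in\mathbb D:\rho(z,[0,\xi])\le a+\log\rho(z,0)\}.$$ A function *converges admissibly* (resp. *enlarged-admissibly*)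 at $\xi$ to $\ell\in\mathbb C$ if for every $a\ge 0$ it tends to $\ell$ as $z\to\xi$ within $\Gamma_a(\xi)$ (resp. within $\Gamma_{(a)}(\xi)$). **Corollary.** Let $\lambda\in\mathbb C\setminus(-\infty,-\frac14)$, let $n\ge0$, let $f$ be a regular $\lambda$-polyharmonic function of order $n+1$, and let $\nu_n$ be the highest-order representing measure of $f$ in (1). Then there is $r<1$ such that $\Phi_n(z\,|\,\lambda)\ne0$ for all $z\in\mathbb D$ with $|z|\ge r$, and for $\mathsf m$-almost every $\xi\in\partial\mathbb D$ the quotient $f(z)/\Phi_n(z\,|\,\lambda)$ converges admissibly at $\xi$ to $\frac{d\nu_n^{\mathrm{ac}}}{d\mathsf m}(\xi)$, where $\nu_n^{\mathrm{ac}}$ is the absolutely continuous part of $\nu_n$ with respect to $\mathsf m$. If $\lambda=-\frac14$, then for $\mathsf m$-almost every $\xi$ the quotient converges even enlarged-admissibly at $\xi$ to the same limit. -/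

import Mathlib

open MeasureTheory Metric Set Filter Topology InnerProductSpace
open scoped Laplacian ComplexConjugate

namespace HypDisk

noncomputable section

/-! ### The disk, its boundary and the hyperbolic metric -/

/-- The boundary `∂𝔻` of the open unit disk `𝔻 = ball (0 : ℂ) 1`. -/
abbrev Boundary : Type := sphere (0 : ℂ) 1

/-- The boundary point `e^{it}`. -/
def boundaryPoint (t : ℝ) : Boundary := ⟨Complex.exp (t * Complex.I), by simp⟩

/-- Normalised arc length (Lebesgue) measure on the unit circle. -/
def arcMeasure : Measure Boundary :=
  ENNReal.ofReal (1 / (2 * Real.pi)) •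
    (volume.restrict (Ioc (-Real.pi) Real.pi)).map boundaryPoint

/-- The hyperbolic distance between two points of the disk. -/
def hypDist (z w : ℂ) : ℝ :=
  Real.log ((‖1 - z * conj w‖ + ‖z - w‖) / (‖1 - z * conj w‖ - ‖z - w‖))

/-- Hyperbolic distance from `z` to the radius joining `0` to the boundary point `ξ`
(whose endpoint `ξ` lies at infinite distance, so that only the points in the open disk count). -/
def distToRadius (z : ℂ) (ξ : Boundary) : ℝ :=
  sInf (hypDist z '' (segment ℝ 0 (ξ : ℂ) ∩ ball (0 : ℂ) 1))

/-- The admissible (tubular, non-tangential) region of width `a` at `ξ`. -/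
def admissibleRegion (a : ℝ) (ξ : Boundary) : Set ℂ :=
  {z | z ∈ ball (0 : ℂ) 1 ∧ distToRadius z ξ ≤ a}

/-- The enlarged-admissible region of width `a` at `ξ`. -/
def enlargedRegion (a : ℝ) (ξ : Boundary) : Set ℂ :=
  {z | z ∈ ball (0 : ℂ) 1 ∧ distToRadius z ξ ≤ a + Real.log (hypDist z 0)}

/-- `g` converges admissibly at `ξ`, with limit `l`. -/
def ConvergesAdmissibly (g : ℂ → ℂ) (ξ : Boundary) (l : ℂ) : Prop :=
  ∀ a : ℝ, 0 ≤ a → Tendsto g (𝓝[admissibleRegion a ξ] (ξ : ℂ)) (𝓝 l)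

/-- `g` converges enlarged-admissibly at `ξ`, with limit `l`. -/
def ConvergesEnlargedAdmissibly (g : ℂ → ℂ) (ξ : Boundary) (l : ℂ) : Prop :=
  ∀ a : ℝ, 0 ≤ a → Tendsto g (𝓝[enlargedRegion a ξ] (ξ : ℂ)) (𝓝 l)

/-! ### Polyharmonic functions -/

/-- The hyperbolic Laplacian `((1 - |z|²)² / 4) (∂ₓ² + ∂ᵧ²)`. -/
def hypLaplacian (f : ℂ → ℂ) (z : ℂ) : ℂ :=
  ((((1 - ‖z‖ ^ 2) ^ 2 / 4 : ℝ)) : ℂ) * (Δ f) z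

/-- `f` is `lam`-polyharmonic of order `m` on the disk: `f` has the `2m` continuous derivatives
that are needed to apply `(L - lam)^m`, and `(L - lam)^m f = 0` on the disk, where `L` is the
hyperbolic Laplacian. The values of `f` outside of the disk are irrelevant. -/
def IsPolyharmonic (lam : ℂ) (m : ℕ) (f : ℂ → ℂ) : Prop :=
  ContDiffOn ℝ ((2 * m : ℕ) : WithTop ℕ∞) f (ball (0 : ℂ) 1) ∧
    ∀ z ∈ ball (0 : ℂ) 1,
      ((fun (g : ℂ → ℂ) (w : ℂ) => hypLaplacian g w - lam * g w)^[m] f) z = 0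

/-! ### Poisson kernels and polyspherical functions -/

/-- The principal square root of `lam + 1/4`. -/
def rootParam (lam : ℂ) : ℂ := (lam + 1 / 4) ^ (1 / 2 : ℂ)

/-- The Poisson kernel `(1 - |z|²) / |ξ - z|²`. -/
def poissonKernel (z : ℂ) (ξ : Boundary) : ℝ := (1 - ‖z‖ ^ 2) / ‖(ξ : ℂ) - z‖ ^ 2

/-- The Busemann function, characterised by `P(z, ξ) = exp (-busemann z ξ)`. -/
def busemann (z : ℂ) (ξ : Boundary) : ℝ := -Real.log (poissonKernel z ξ)

/-- The `lam`-polyharmonic Poisson kernel `P_n(z, ξ | lam)` (of order `n + 1`). -/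
def polyKernel (lam : ℂ) (n : ℕ) (z : ℂ) (ξ : Boundary) : ℂ :=
  open Classical in
  if lam = -1 / 4 then
    1 / ((2 * n).factorial : ℂ) * (busemann z ξ : ℂ) ^ (2 * n) *
      (poissonKernel z ξ : ℂ) ^ (1 / 2 : ℂ)
  else
    1 / ((n.factorial : ℂ) * (2 * rootParam lam) ^ n) * (-(busemann z ξ : ℂ)) ^ n *
      (poissonKernel z ξ : ℂ) ^ (rootParam lam + 1 / 2)

/-- The `n`-th `lam`-polyspherical function. -/
def polyspherical (lam : ℂ) (n : ℕ) (z : ℂ) : ℂ :=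
  ∫ ξ, polyKernel lam n z ξ ∂arcMeasure

/-! ### Analytic functionals on the circle -/

/-- The open annulus `1 - δ < |w| < 1 + δ`. -/
def annulus (δ : ℝ) : Set ℂ := {w | 1 - δ < ‖w‖ ∧ ‖w‖ < 1 + δ}

lemma annulus_mono {δ ε : ℝ} (h : δ ≤ ε) : annulus δ ⊆ annulus ε := by
  intro w hw
  exact ⟨by linarith [hw.1], by linarith [hw.2]⟩

/-- The space `ℋ(∂𝔻)` of analytic functions on the unit circle, i.e. functions with a holomorphic
extension to some annulus around it. -/
def analyticFunctions : Submodule ℂ (Boundary → ℂ) where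
  carrier := {g | ∃ δ : ℝ, 0 < δ ∧ ∃ G : ℂ → ℂ,
    DifferentiableOn ℂ G (annulus δ) ∧ ∀ ξ : Boundary, G ξ = g ξ}
  zero_mem' := ⟨1, one_pos, fun _ => 0, differentiableOn_const 0, fun _ => rfl⟩
  add_mem' := by
    rintro a b ⟨δ, hδ, G, hG, hGa⟩ ⟨ε, hε, H, hH, hHb⟩
    refine ⟨min δ ε, lt_min hδ hε, fun w => G w + H w, ?_, fun ξ => ?_⟩
    · exact (hG.mono (annulus_mono (min_le_left _ _))).add
        (hH.mono (annulus_mono (min_le_right _ _)))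
    · simp [hGa, hHb]
  smul_mem' := by
    rintro c a ⟨δ, hδ, G, hG, hGa⟩
    exact ⟨δ, hδ, fun w => c * G w, hG.const_mul c, fun ξ => by simp [hGa]⟩

/-- An analytic functional: a linear functional on `ℋ(∂𝔻)` that is continuous for the inductive
limit topology. This means that for each `δ > 0` its restriction to the holomorphic functions on
`annulus δ`, with the topology of uniform convergence on compact sets, is continuous, i.e. bounded
by a multiple of the supremum over some compact subset. -/
structure AnalyticFunctional where
  toLinearMap : analyticFunctions →ₗ[ℂ] ℂ
  continuous_restriction : ∀ δ : ℝ, 0 < δ → ∃ K : Set ℂ, IsCompact K ∧ K ⊆ annulus δ ∧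
    ∃ C : ℝ, ∀ (g : analyticFunctions) (G : ℂ → ℂ), DifferentiableOn ℂ G (annulus δ) →
      (∀ ξ : Boundary, G ξ = (g : Boundary → ℂ) ξ) →
      ∀ M : ℝ, 0 ≤ M → (∀ w ∈ K, ‖G w‖ ≤ M) → ‖toLinearMap g‖ ≤ C * M

/-- The analytic functional `ν` is (given by integration against) the complex Borel measure `μ`. -/
def AnalyticFunctional.IsMeasure (ν : AnalyticFunctional) (μ : ComplexMeasure Boundary) : Prop :=
  ∀ g : analyticFunctions,
    ν.toLinearMap g = VectorMeasure.integral μ (g : Boundary → ℂ) (ContinuousLinearMap.mul ℝ ℂ)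

/-- The holomorphic extension of `ξ ↦ log P(z, ξ)`. -/
def logPoissonExt (z w : ℂ) : ℂ :=
  (Real.log (1 - ‖z‖ ^ 2) : ℂ) - Complex.log (1 - z / w) - Complex.log (1 - conj z * w)

lemma annulus_bounds {z w : ℂ} (hz : ‖z‖ < 1) (hw : w ∈ annulus (1 - ‖z‖)) :
    w ≠ 0 ∧ ‖z / w‖ < 1 ∧ ‖conj z * w‖ < 1 := by
  obtain ⟨h1, h2⟩ := hw
  have h0 := norm_nonneg z
  have hw0 : 0 < ‖w‖ := by linarith
  refine ⟨norm_pos_iff.1 hw0, ?_, ?_⟩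
  · rw [norm_div, div_lt_one hw0]
    linarith
  · rw [norm_mul, RCLike.norm_conj]
    nlinarith [sq_nonneg (1 - ‖z‖), sq_pos_of_pos (sub_pos.2 hz)]

lemma one_sub_mem_slitPlane {u : ℂ} (hu : ‖u‖ < 1) : 1 - u ∈ Complex.slitPlane := by
  rw [sub_eq_add_neg]
  exact Complex.mem_slitPlane_of_norm_lt_one (by rwa [norm_neg])

lemma differentiableOn_logPoissonExt {z : ℂ} (hz : ‖z‖ < 1) :
    DifferentiableOn ℂ (logPoissonExt z) (annulus (1 - ‖z‖)) := by
  intro w hw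
  obtain ⟨hw0, h1, h2⟩ := annulus_bounds hz hw
  have e1 : DifferentiableAt ℂ (fun w : ℂ => Complex.log (1 - z / w)) w :=
    DifferentiableAt.clog (by fun_prop (disch := assumption)) (one_sub_mem_slitPlane h1)
  have e2 : DifferentiableAt ℂ (fun w : ℂ => Complex.log (1 - conj z * w)) w :=
    DifferentiableAt.clog (by fun_prop) (one_sub_mem_slitPlane h2)
  exact (((differentiableAt_const _).sub e1).sub e2).differentiableWithinAt

lemma poissonKernel_pos {z : ℂ} (hz : ‖z‖ < 1) (ξ : Boundary) : 0 < poissonKernel z ξ := by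
  have hξ : ‖(ξ : ℂ)‖ = 1 := by simp
  have h0 := norm_nonneg z
  have hne : (ξ : ℂ) - z ≠ 0 := by
    intro h
    rw [sub_eq_zero.1 h] at hξ
    linarith
  have : 0 < ‖(ξ : ℂ) - z‖ := norm_pos_iff.2 hne
  unfold poissonKernel
  apply div_pos _ (by positivity)
  nlinarith

lemma logPoissonExt_eq {z : ℂ} (hz : ‖z‖ < 1) (ξ : Boundary) :
    logPoissonExt z ξ = (Real.log (poissonKernel z ξ) : ℂ) := by
  have hξ : ‖(ξ : ℂ)‖ = 1 := by simp
  have h0 := norm_nonneg z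
  have hu : ‖z / (ξ : ℂ)‖ < 1 := by rw [norm_div, hξ, div_one]; exact hz
  have hinv : (ξ : ℂ)⁻¹ = conj (ξ : ℂ) := Complex.inv_eq_conj hξ
  have hc : (1 : ℂ) - conj z * (ξ : ℂ) = conj (1 - z / (ξ : ℂ)) := by
    rw [div_eq_mul_inv, hinv]
    simp
  have hlog : Complex.log (1 - conj z * (ξ : ℂ)) = conj (Complex.log (1 - z / (ξ : ℂ))) := by
    rw [hc, Complex.log_conj]
    exact Complex.slitPlane_arg_ne_pi (one_sub_mem_slitPlane hu)
  have hsum : Complex.log (1 - z / (ξ : ℂ)) + conj (Complex.log (1 - z / (ξ : ℂ)))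
      = ((2 * Real.log ‖1 - z / (ξ : ℂ)‖ : ℝ) : ℂ) := by
    rw [Complex.add_conj, Complex.log_re]
  have hn : ‖1 - z / (ξ : ℂ)‖ = ‖(ξ : ℂ) - z‖ := by
    have hξ0 : (ξ : ℂ) ≠ 0 := by
      rw [← norm_pos_iff, hξ]
      exact one_pos
    have : (ξ : ℂ) - z = (ξ : ℂ) * (1 - z / (ξ : ℂ)) := by field_simp
    rw [this, norm_mul, hξ, one_mul]
  have hpos : 0 < ‖(ξ : ℂ) - z‖ := by
    rw [← hn, norm_pos_iff]
    exact Complex.slitPlane_ne_zero (one_sub_mem_slitPlane hu)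
  have h1 : (1 - ‖z‖ ^ 2) ≠ 0 := by nlinarith
  unfold logPoissonExt poissonKernel
  rw [Real.log_div h1 (by positivity), Real.log_pow, sub_sub, hlog, hsum, hn]
  push_cast
  ring

/-- For `z` in the disk, `ξ ↦ P_n(z, ξ | lam)` is an analytic function on the circle. -/
lemma polyKernel_mem (lam : ℂ) (n : ℕ) {z : ℂ} (hz : z ∈ ball (0 : ℂ) 1) :
    polyKernel lam n z ∈ analyticFunctions := by
  have hz' : ‖z‖ < 1 := by simpa using hz
  have hd := differentiableOn_logPoissonExt hz'
  have key : ∀ (s : ℂ) (ξ : Boundary),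
      (poissonKernel z ξ : ℂ) ^ s = Complex.exp (logPoissonExt z ξ * s) := by
    intro s ξ
    have hp := poissonKernel_pos hz' ξ
    rw [Complex.cpow_def_of_ne_zero (by exact_mod_cast hp.ne'), logPoissonExt_eq hz',
      Complex.ofReal_log hp.le]
  have hb : ∀ ξ : Boundary, (busemann z ξ : ℂ) = -logPoissonExt z ξ := by
    intro ξ
    rw [logPoissonExt_eq hz', busemann]
    push_cast
    rfl
  by_cases h : lam = -1 / 4
  · refine ⟨1 - ‖z‖, by linarith, fun w => 1 / ((2 * n).factorial : ℂ) *
      (-logPoissonExt z w) ^ (2 * n) * Complex.exp (logPoissonExt z w * (1 / 2 : ℂ)), ?_, ?_⟩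
    · exact ((differentiableOn_const _).mul (hd.neg.pow _)).mul (hd.mul_const _).cexp
    · intro ξ
      simp only [polyKernel, if_pos h, key, hb]
  · refine ⟨1 - ‖z‖, by linarith, fun w => 1 / ((n.factorial : ℂ) * (2 * rootParam lam) ^ n) *
      (-(-logPoissonExt z w)) ^ n *
        Complex.exp (logPoissonExt z w * (rootParam lam + 1 / 2)), ?_, ?_⟩
    · exact ((differentiableOn_const _).mul (hd.neg.neg.pow _)).mul (hd.mul_const _).cexp
    · intro ξ
      simp only [polyKernel, if_neg h, key, hb]

/-- The boundary representation `f(z) = ∑_{k < m} ∫ P_k(z, ξ | lam) dν_k(ξ)` on the disk of a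
function `f` by analytic functionals `ν_0, …, ν_{m-1}`. -/
def IsBoundaryRepresentation (lam : ℂ) {m : ℕ} (f : ℂ → ℂ) (ν : Fin m → AnalyticFunctional) :
    Prop :=
  ∀ (z : ℂ) (hz : z ∈ ball (0 : ℂ) 1),
    f z = ∑ k : Fin m, (ν k).toLinearMap ⟨polyKernel lam k z, polyKernel_mem lam k hz⟩

end

end HypDisk

open HypDisk

open scoped ENNReal NNReal

namespace HypDisk

/-! ### Complex measures -/

section ComplexMeasures

variable {X : Type*} {mX : MeasurableSpace X}

/-! This is a Fatou theorem, proved point by point from the local growth of the measures. Write `m`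
for `arcMeasure` and `h` for the density of `ν_n` with respect to `m`. For almost every `ξ`, every
`|ν_k|` gives balls of radius `r` around `ξ` mass `O(r)`, while the deviation `|ν_n^s| + |h - h(ξ)|
m` gives them mass `o(r)`. This is Lebesgue differentiation for the doubling measure `m`
(`ae_linearGrowth`, `ae_sublinearGrowth_deviation`). Fix such a `ξ`. The multiple `h(ξ) m` of `m`
contributes exactly `h(ξ)` to the quotient. It remains to see that `P_k / Φ_n` sends the other parts
of the measures to `0` (`tendsto_div_polyspherical`).

Let `t = 1 - |z|`, let `L = log (1/t)`, and let `d` be the distance to `ξ` on the circle. Off the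
bottom `λ = -1/4`, put `σ = Re s > 0`. Then `|P_k|` is at most a constant times `L^k P^(σ + 1/2)`,
and `|Φ_n|` is at least a constant times `L^n t^(1/2 - σ)`. In an admissible region the ratio is
therefore at most a constant times `L^(k-n) t^(2σ) max(t,d)^(-1-2σ)`. Since `s` may be complex, the
lower bound cannot come from positivity. Instead the integral is rescaled by `θ = t u`, and its
limit `∫ (2/(1+u²))^(s+1/2) du` is a nonzero Beta value
(`integral_two_div_one_add_sq_cpow_ne_zero`).

At the bottom the integrand is nonnegative and `Φ_n` is at least a constant times `L^(2n+1)
t^(1/2)`. The additional `L` comes from `∫ dθ/θ`, and it pays for the larger region: with `R = t L`,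
the ratio is controlled by `1/R` on `d ≤ 2CR` plus `1 / (log(1/R) max(R,d))`.

Layer-cake integration shows that all these radial majorants have bounded integrals against `O(r)`
measures and vanishing integrals against `o(r)` measures (`LocalKernel`). The negative powers of `L`
remove the orders `k < n`. -/

theorem variation_le_re_add_im (c : ComplexMeasure X) :
    c.variation ≤ (ComplexMeasure.re c).totalVariation + (ComplexMeasure.im c).totalVariation := by
  refine VectorMeasure.variation_le_of_forall_enorm_le fun E _ => ?_
  rw [Measure.add_apply]
  have h1 := (ComplexMeasure.re c).enorm_le_totalVariation E
  have h2 := (ComplexMeasure.im c).enorm_le_totalVariation E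
  refine le_trans ?_ (add_le_add h1 h2)
  change ‖c E‖ₑ ≤ ‖(c E).re‖ₑ + ‖(c E).im‖ₑ
  simp only [enorm_eq_nnnorm]
  rw [← ENNReal.coe_add]
  exact_mod_cast Complex.norm_le_abs_re_add_abs_im (c E)

instance isFiniteMeasure_variation (c : ComplexMeasure X) : IsFiniteMeasure c.variation := by
  have : IsFiniteMeasure
      ((ComplexMeasure.re c).totalVariation + (ComplexMeasure.im c).totalVariation) := by
    unfold SignedMeasure.totalVariation
    infer_instance
  exact isFiniteMeasure_of_le _ (variation_le_re_add_im c)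

theorem variation_singularPart_mutuallySingular (c : ComplexMeasure X) (μ : Measure X) :
    (c.singularPart μ).variation ⟂ₘ μ := by
  refine Measure.MutuallySingular.mono ?_ (variation_le_re_add_im _) le_rfl
  have h (s : SignedMeasure X) : (s.singularPart μ).totalVariation ⟂ₘ μ := by
    have := s.mutuallySingular_singularPart μ
    rwa [SignedMeasure.mutuallySingular_ennreal_iff,
      VectorMeasure.ennrealToMeasure_toENNRealVectorMeasure] at this
  exact (h (ComplexMeasure.re c)).add_left (h (ComplexMeasure.im c))

/-- Both sides are continuous in `K` for the `L¹` norm, the left one because the variation is `‖a‖ₑ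
• μ`; this reduces the claim to indicators. -/
theorem integral_withDensityᵥ_const {μ : Measure X} [IsFiniteMeasure μ] {K : X → ℂ}
    (hK : Integrable K μ) (a : ℂ) :
    VectorMeasure.integral (μ.withDensityᵥ fun _ => a) K (ContinuousLinearMap.mul ℝ ℂ) =
      (∫ x, K x ∂μ) * a := by
  have hv : (μ.withDensityᵥ fun _ : X => a).variation = ‖a‖ₑ • μ := by
    rw [Measure.variation_withDensityᵥ (integrable_const a), withDensity_const]
  have hint {f : X → ℂ} (hf : Integrable f μ) : (μ.withDensityᵥ fun _ : X => a).Integrable f := by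
    rw [VectorMeasure.Integrable, hv]
    exact hf.smul_measure (by simp)
  refine Integrable.induction
    (P := fun f => VectorMeasure.integral (μ.withDensityᵥ fun _ => a) f
      (ContinuousLinearMap.mul ℝ ℂ) = (∫ x, f x ∂μ) * a) ?_ ?_ ?_ ?_ hK
  · intro b s hs _
    rw [VectorMeasure.integral_indicator_const _ hs, integral_indicator_const b hs,
      withDensityᵥ_apply (integrable_const a) hs, setIntegral_const]
    simp only [ContinuousLinearMap.mul_apply', Complex.real_smul]
    ring
  · intro f g _ hf hg h1 h2
    simp only [Pi.add_apply]
    rw [VectorMeasure.integral_add (hint hf) (hint hg), integral_add hf hg, h1, h2, add_mul]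
  · have hcont : Continuous fun f : X →₁[μ] ℂ => VectorMeasure.integral
        (μ.withDensityᵥ fun _ => a) f (ContinuousLinearMap.mul ℝ ℂ) := by
      refine LipschitzWith.continuous (K := ‖a‖₊) fun f g => ?_
      refine (VectorMeasure.edist_integral_le_lintegral_edist (hint (L1.integrable_coeFn f))
        (hint (L1.integrable_coeFn g))).trans ?_
      rw [hv, lintegral_smul_measure, L1.edist_def, enorm_eq_nnnorm]
      refine mul_le_of_le_one_left' ?_
      exact_mod_cast ContinuousLinearMap.opNorm_mul_le ℝ ℂ
    exact isClosed_eq hcont (continuous_integral.mul continuous_const)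
  · intro f g hfg hf h
    rw [← integral_congr_ae hfg, ← h]
    refine (VectorMeasure.integral_congr_ae ?_).symm
    rw [hv]
    exact Measure.ae_smul_measure hfg _

theorem enorm_vectorIntegral_le (c : ComplexMeasure X) (K : X → ℂ) :
    ‖VectorMeasure.integral c K (ContinuousLinearMap.mul ℝ ℂ)‖ₑ ≤ ∫⁻ x, ‖K x‖ₑ ∂c.variation := by
  refine VectorMeasure.enorm_integral_le_lintegral_enorm.trans ?_
  refine mul_le_of_le_one_left' ?_
  rw [enorm_eq_nnnorm]
  exact_mod_cast ContinuousLinearMap.opNorm_mul_le ℝ ℂ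

/-- The deviation of `c` from the multiple `c.rnDeriv μ x₀ • μ` of `μ`. -/
noncomputable def deviation (c : ComplexMeasure X) (μ : Measure X) (x₀ : X) : Measure X :=
  (c.singularPart μ).variation + μ.withDensity fun x => ‖c.rnDeriv μ x - c.rnDeriv μ x₀‖ₑ

instance (c : ComplexMeasure X) (μ : Measure X) [IsFiniteMeasure μ] (x₀ : X) :
    IsFiniteMeasure (deviation c μ x₀) := by
  have : IsFiniteMeasure (μ.withDensity fun x => ‖c.rnDeriv μ x - c.rnDeriv μ x₀‖ₑ) :=
    isFiniteMeasure_withDensity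
      (((ComplexMeasure.integrable_rnDeriv c μ).sub (integrable_const _)).2.ne)
  unfold deviation
  infer_instance

/-- Write `h` for the density and split `c` as its singular part, plus `(h - h x₀) μ`, plus `h x₀ •
μ`. The last piece produces exactly the subtracted term, and the variations of the first two add up
to `deviation`. -/
theorem enorm_vectorIntegral_sub_le (c : ComplexMeasure X) (μ : Measure X) [IsFiniteMeasure μ]
    (x₀ : X) {K : X → ℂ} (hKm : Measurable K) {M : ℝ} (hKb : ∀ x, ‖K x‖ ≤ M) :
    ‖VectorMeasure.integral c K (ContinuousLinearMap.mul ℝ ℂ) -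
      (∫ x, K x ∂μ) * c.rnDeriv μ x₀‖ₑ ≤ ∫⁻ x, ‖K x‖ₑ ∂(deviation c μ x₀) := by
  have hint (ν : Measure X) [IsFiniteMeasure ν] : Integrable K ν :=
    Integrable.of_bound hKm.aestronglyMeasurable M (Eventually.of_forall hKb)
  have : c.HaveLebesgueDecomposition μ := ⟨inferInstance, inferInstance⟩
  have hi : Integrable (fun x => c.rnDeriv μ x - c.rnDeriv μ x₀) μ :=
    (ComplexMeasure.integrable_rnDeriv c μ).sub (integrable_const (c.rnDeriv μ x₀))
  have hdec : c = c.singularPart μ +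
      (μ.withDensityᵥ (fun x => c.rnDeriv μ x - c.rnDeriv μ x₀) +
        μ.withDensityᵥ fun _ => c.rnDeriv μ x₀) := by
    rw [← withDensityᵥ_add' hi (integrable_const _)]
    simp only [sub_add_cancel]
    exact (ComplexMeasure.singularPart_add_withDensity_rnDeriv_eq).symm
  conv_lhs => enter [1, 1, 1]; rw [hdec]
  rw [VectorMeasure.integral_add_vectorMeasure (hint _) (hint _),
    VectorMeasure.integral_add_vectorMeasure (hint _) (hint _),
    integral_withDensityᵥ_const (hint μ), ← add_assoc, add_sub_cancel_right, deviation,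
    lintegral_add_measure, ← Measure.variation_withDensityᵥ hi]
  exact (enorm_add_le _ _).trans
    (add_le_add (enorm_vectorIntegral_le _ _) (enorm_vectorIntegral_le _ _))

end ComplexMeasures

/-! ### Arc length -/

theorem continuous_boundaryPoint : Continuous boundaryPoint := by
  unfold boundaryPoint
  fun_prop

theorem exists_boundaryPoint (x : Boundary) : ∃ φ ∈ Ioc (-Real.pi) Real.pi, boundaryPoint φ = x := by
  refine ⟨Complex.arg x, Complex.arg_mem_Ioc _, Subtype.ext ?_⟩
  have h := Complex.norm_mul_exp_arg_mul_I (x : ℂ)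
  have hx : ‖(x : ℂ)‖ = 1 := by simp
  rw [hx] at h
  simpa [boundaryPoint] using h

theorem dist_boundaryPoint (a b : ℝ) :
    dist (boundaryPoint a) (boundaryPoint b) = 2 * |Real.sin ((a - b) / 2)| := by
  rw [Subtype.dist_eq, dist_eq_norm]
  have : (boundaryPoint a : ℂ) - boundaryPoint b =
      boundaryPoint b * (Complex.exp (Complex.I * (a - b : ℝ)) - 1) := by
    simp only [boundaryPoint, mul_sub, ← Complex.exp_add, mul_one]
    congr 2
    push_cast
    ring
  rw [this, norm_mul, Complex.norm_exp_I_mul_ofReal_sub_one]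
  simp

theorem arcMeasure_apply {s : Set Boundary} (hs : MeasurableSet s) :
    arcMeasure s = ENNReal.ofReal (1 / (2 * Real.pi)) *
      volume (boundaryPoint ⁻¹' s ∩ Ioc (-Real.pi) Real.pi) := by
  rw [arcMeasure, Measure.smul_apply, Measure.map_apply continuous_boundaryPoint.measurable hs,
    Measure.restrict_apply (continuous_boundaryPoint.measurable hs), smul_eq_mul]

instance isProbabilityMeasure_arcMeasure : IsProbabilityMeasure arcMeasure := by
  constructor
  rw [arcMeasure_apply MeasurableSet.univ, preimage_univ, univ_inter, Real.volume_Ioc,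
    ← ENNReal.ofReal_mul (by positivity)]
  have := Real.pi_pos
  rw [show 1 / (2 * Real.pi) * (Real.pi - -Real.pi) = 1 by field_simp; ring, ENNReal.ofReal_one]

/-- Jordan's inequality turns a chord of length at most `r` into an angle of at most `π r / 2`,
modulo `2π`. The three possible shifts give three intervals of length `π r`, and `3 π r / (2π) =
3r/2`. -/
theorem arcMeasure_closedBall_le (x : Boundary) {r : ℝ} (hr : 0 ≤ r) :
    arcMeasure (closedBall x r) ≤ ENNReal.ofReal (3 / 2 * r) := by
  obtain ⟨φ, hφ, rfl⟩ := exists_boundaryPoint x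
  have hpi := Real.pi_pos
  have key : boundaryPoint ⁻¹' closedBall (boundaryPoint φ) r ∩ Ioc (-Real.pi) Real.pi ⊆
      closedBall φ (Real.pi / 2 * r) ∪ (closedBall (φ + 2 * Real.pi) (Real.pi / 2 * r) ∪
        closedBall (φ - 2 * Real.pi) (Real.pi / 2 * r)) := by
    rintro t ⟨ht, ht'⟩
    rw [mem_preimage, mem_closedBall, dist_boundaryPoint] at ht
    have hlin {u : ℝ} (hu : |u| ≤ Real.pi) (h : |Real.sin (u / 2)| = |Real.sin ((t - φ) / 2)|) :
        |u| ≤ Real.pi / 2 * r := by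
      have h1 : |u / 2| ≤ Real.pi / 2 := by rw [abs_div, abs_two]; linarith
      have h2 := Real.mul_abs_le_abs_sin h1
      rw [h, abs_div, abs_two] at h2
      have h3 : 2 / Real.pi * (|u| / 2) = |u| / Real.pi := by field_simp
      rw [h3] at h2
      have h4 : |u| / Real.pi ≤ r / 2 := by linarith
      rw [div_le_iff₀ hpi] at h4
      linarith
    simp only [mem_union, mem_closedBall, Real.dist_eq]
    rcases le_or_gt |t - φ| Real.pi with h | h
    · exact Or.inl (hlin h rfl)
    · rcases lt_abs.1 h with h | h
      · refine Or.inr (Or.inl (hlin ?_ ?_))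
        · rw [abs_le]; constructor <;> linarith [ht'.1, ht'.2, hφ.1, hφ.2]
        · rw [show (t - (φ + 2 * Real.pi)) / 2 = (t - φ) / 2 - Real.pi by ring, Real.sin_sub_pi,
            abs_neg]
      · refine Or.inr (Or.inr (hlin ?_ ?_))
        · rw [abs_le]; constructor <;> linarith [ht'.1, ht'.2, hφ.1, hφ.2]
        · rw [show (t - (φ - 2 * Real.pi)) / 2 = (t - φ) / 2 + Real.pi by ring, Real.sin_add_pi,
            abs_neg]
  rw [arcMeasure_apply measurableSet_closedBall]
  have h0 : 0 ≤ 2 * (Real.pi / 2 * r) := by positivity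
  calc _ ≤ ENNReal.ofReal (1 / (2 * Real.pi)) * (ENNReal.ofReal (2 * (Real.pi / 2 * r)) +
        (ENNReal.ofReal (2 * (Real.pi / 2 * r)) + ENNReal.ofReal (2 * (Real.pi / 2 * r)))) := by
        gcongr
        refine (measure_mono key).trans ((measure_union_le _ _).trans (add_le_add ?_
          ((measure_union_le _ _).trans (add_le_add ?_ ?_)))) <;> rw [Real.volume_closedBall]
    _ = _ := by
        rw [← ENNReal.ofReal_add h0 h0, ← ENNReal.ofReal_add h0 (by positivity),
          ← ENNReal.ofReal_mul (by positivity)]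
        congr 1
        field_simp
        ring

theorem le_arcMeasure_closedBall (x : Boundary) {r : ℝ} (hr : 0 ≤ r) (hr' : r ≤ 2) :
    ENNReal.ofReal (1 / (2 * Real.pi) * r) ≤ arcMeasure (closedBall x r) := by
  obtain ⟨φ, hφ, rfl⟩ := exists_boundaryPoint x
  have hpi := Real.pi_gt_three
  rw [arcMeasure_apply measurableSet_closedBall, ENNReal.ofReal_mul (by positivity)]
  gcongr
  have hsub {t : ℝ} (ht : |t - φ| ≤ r) : t ∈ boundaryPoint ⁻¹' closedBall (boundaryPoint φ) r := by
    rw [mem_preimage, mem_closedBall, dist_boundaryPoint]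
    have := Real.abs_sin_le_abs (x := (t - φ) / 2)
    rw [abs_div, abs_two] at this
    linarith
  -- Only the half arc pointing away from the nearer end of `(-π, π]` is measured; it does not reach
  -- the other end because `r ≤ 2 < π`.
  rcases le_or_gt 0 φ with h | h
  · calc ENNReal.ofReal r = volume (Ioc (φ - r) φ) := by rw [Real.volume_Ioc]; congr 1; ring
      _ ≤ _ := by
        refine measure_mono fun t ht => ⟨hsub ?_, ?_, ?_⟩
        · rw [abs_le]; constructor <;> linarith [ht.1, ht.2]
        · linarith [ht.1]
        · linarith [ht.2, hφ.2]
  · calc ENNReal.ofReal r = volume (Ioc φ (φ + r)) := by rw [Real.volume_Ioc]; congr 1; ring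
      _ ≤ _ := by
        refine measure_mono fun t ht => ⟨hsub ?_, ?_, ?_⟩
        · rw [abs_le]; constructor <;> linarith [ht.1, ht.2]
        · linarith [ht.1, hφ.1]
        · linarith [ht.2]

instance isUnifLocDoublingMeasure_arcMeasure : IsUnifLocDoublingMeasure arcMeasure := by
  have hpi := Real.pi_pos
  -- The upper bound `3/2 * (2r)` divided by the lower bound `r / (2π)`.
  refine ⟨⟨(6 * Real.pi).toNNReal, ?_⟩⟩
  have : Ioc (0 : ℝ) 2 ∈ 𝓝[>] (0 : ℝ) := Ioc_mem_nhdsGT two_pos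
  filter_upwards [this] with r hr x
  refine (arcMeasure_closedBall_le x (by linarith [hr.1])).trans
    (le_trans ?_ (mul_le_mul_right (le_arcMeasure_closedBall x hr.1.le hr.2) _))
  rw [ENNReal.ofNNReal_toNNReal, ← ENNReal.ofReal_mul (by positivity)]
  apply ENNReal.ofReal_le_ofReal
  field_simp
  linarith

/-! ### Differentiation of measures -/

/-- `τ (closedBall x r) = O(r)` as `r → 0`. -/
def LinearGrowth (τ : Measure Boundary) (x : Boundary) : Prop :=
  ∃ M : ℝ, 0 ≤ M ∧ ∃ r₀ > 0, ∀ r, 0 < r → r ≤ r₀ → τ (closedBall x r) ≤ ENNReal.ofReal (M * r)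

/-- `τ (closedBall x r) = o(r)` as `r → 0`. -/
def SublinearGrowth (τ : Measure Boundary) (x : Boundary) : Prop :=
  ∀ ε : ℝ, 0 < ε → ∃ r₀ > 0, ∀ r, 0 < r → r ≤ r₀ → τ (closedBall x r) ≤ ENNReal.ofReal (ε * r)

/-- Multiply the eventual bound on the ratio by the measure of the ball, which is at most `3r/2 ≤
2r`. -/
theorem exists_growth_of_tendsto {τ : Measure Boundary} {x : Boundary} {l : ℝ≥0∞} {ε : ℝ}
    (h : Tendsto (fun r => τ (closedBall x r) / arcMeasure (closedBall x r)) (𝓝[>] 0) (𝓝 l))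
    (hl : l < ENNReal.ofReal ε) :
    ∃ r₀ > 0, ∀ r, 0 < r → r ≤ r₀ → τ (closedBall x r) ≤ ENNReal.ofReal (ε * 2 * r) := by
  have hε : 0 < ε := ENNReal.ofReal_pos.1 (pos_of_gt hl)
  have h1 : ∀ᶠ r in 𝓝[>] (0 : ℝ), τ (closedBall x r) / arcMeasure (closedBall x r)
      < ENNReal.ofReal ε := h.eventually_lt_const hl
  obtain ⟨r₁, hr₁, h2⟩ := mem_nhdsGT_iff_exists_Ioc_subset.1 h1
  refine ⟨min r₁ 2, lt_min hr₁ two_pos, fun r hr hr' => ?_⟩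
  have h3 : τ (closedBall x r) / arcMeasure (closedBall x r) ≤ ENNReal.ofReal ε :=
    le_of_lt (h2 ⟨hr, hr'.trans (min_le_left _ _)⟩)
  have h4 := arcMeasure_closedBall_le x hr.le
  have h5 := le_arcMeasure_closedBall x hr.le (hr'.trans (min_le_right _ _))
  rw [ENNReal.div_le_iff (lt_of_lt_of_le (ENNReal.ofReal_pos.2 (by positivity)) h5).ne'
    (measure_ne_top _ _)] at h3
  refine h3.trans ((mul_le_mul_right h4 _).trans ?_)
  rw [← ENNReal.ofReal_mul hε.le]
  apply ENNReal.ofReal_le_ofReal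
  nlinarith

theorem ae_tendsto_closedBall_div (τ : Measure Boundary) [IsFiniteMeasure τ] :
    ∀ᵐ x ∂arcMeasure, Tendsto (fun r => τ (closedBall x r) / arcMeasure (closedBall x r))
      (𝓝[>] 0) (𝓝 (τ.rnDeriv arcMeasure x)) := by
  filter_upwards [(IsUnifLocDoublingMeasure.vitaliFamily arcMeasure 1).ae_tendsto_rnDeriv τ]
    with x hx
  refine hx.comp (IsUnifLocDoublingMeasure.tendsto_closedBall_filterAt arcMeasure
    (fun _ => x) (fun r => r) tendsto_id ?_)
  filter_upwards [self_mem_nhdsWithin] with r (hr : 0 < r)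
  simp [hr.le]

theorem ae_linearGrowth (τ : Measure Boundary) [IsFiniteMeasure τ] :
    ∀ᵐ x ∂arcMeasure, LinearGrowth τ x := by
  filter_upwards [ae_tendsto_closedBall_div τ, τ.rnDeriv_lt_top arcMeasure] with x hx hx'
  obtain ⟨M, hM⟩ := ENNReal.lt_iff_exists_nnreal_btwn.1 hx'
  obtain ⟨r₀, hr₀, h⟩ := exists_growth_of_tendsto (ε := M) hx (by simpa using hM.1)
  exact ⟨M * 2, by positivity, r₀, hr₀, h⟩

theorem sublinearGrowth_of_tendsto {τ : Measure Boundary} {x : Boundary}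
    (h : Tendsto (fun r => τ (closedBall x r) / arcMeasure (closedBall x r)) (𝓝[>] 0) (𝓝 0)) :
    SublinearGrowth τ x := by
  intro ε hε
  obtain ⟨r₀, hr₀, h⟩ := exists_growth_of_tendsto (ε := ε / 2) h (by simpa using hε)
  exact ⟨r₀, hr₀, fun r hr hr' => by simpa using h r hr hr'⟩

/-- The singular part has derivative zero almost everywhere, and almost every point is a Lebesgue
point of the density. The deviation itself depends on the point, so the two facts are combined only
after `x` is fixed. -/
theorem ae_sublinearGrowth_deviation (c : ComplexMeasure Boundary) :
    ∀ᵐ x ∂arcMeasure, SublinearGrowth (deviation c arcMeasure x) x := by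
  have h2 : ∀ᵐ x ∂arcMeasure, Tendsto (fun r => (∫⁻ y in closedBall x r,
      ‖c.rnDeriv arcMeasure y - c.rnDeriv arcMeasure x‖ₑ ∂arcMeasure) /
        arcMeasure (closedBall x r)) (𝓝[>] 0) (𝓝 0) := by
    filter_upwards [(IsUnifLocDoublingMeasure.vitaliFamily arcMeasure
      1).ae_tendsto_lintegral_enorm_sub_div_of_integrable
        (ComplexMeasure.integrable_rnDeriv c arcMeasure)] with x hx
    refine hx.comp (IsUnifLocDoublingMeasure.tendsto_closedBall_filterAt arcMeasure
      (fun _ => x) (fun r => r) tendsto_id ?_)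
    filter_upwards [self_mem_nhdsWithin] with r (hr : 0 < r)
    simp [hr.le]
  filter_upwards [h2, ae_tendsto_closedBall_div (c.singularPart arcMeasure).variation,
    (variation_singularPart_mutuallySingular c arcMeasure).rnDeriv_ae_eq_zero] with x h2 h1 h3
  rw [h3] at h1
  refine sublinearGrowth_of_tendsto ?_
  have := h1.add h2
  simp only [Pi.zero_apply, add_zero] at this
  refine this.congr fun r => ?_
  rw [deviation, Measure.add_apply, withDensity_apply _ measurableSet_closedBall, ENNReal.add_div]

/-! ### Radial kernels against measures of linear growth -/

/-- A family `W R` of radial kernels whose integral against a measure `τ` is controlled, as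
`R → 0`, by the local growth of `τ`. -/
def LocalKernel (W : ℝ → ℝ → ℝ) : Prop :=
  ∃ D : ℝ, 0 ≤ D ∧ ∀ (τ : Measure Boundary) [IsFiniteMeasure τ] (x : Boundary) (ε : ℝ), 0 < ε →
    (∃ r₀ > 0, ∀ r, 0 < r → r ≤ r₀ → τ (closedBall x r) ≤ ENNReal.ofReal (ε * r)) →
    ∀ᶠ R in 𝓝[>] 0, ∫⁻ y, ENNReal.ofReal (W R (dist y x)) ∂τ ≤ ENNReal.ofReal (D * ε)

theorem LocalKernel.tendsto {W : ℝ → ℝ → ℝ} (hW : LocalKernel W) {τ : Measure Boundary}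
    [IsFiniteMeasure τ] {x : Boundary} (h : SublinearGrowth τ x) :
    Tendsto (fun R => ∫⁻ y, ENNReal.ofReal (W R (dist y x)) ∂τ) (𝓝[>] 0) (𝓝 0) := by
  obtain ⟨D, hD, hW⟩ := hW
  rw [ENNReal.tendsto_nhds_zero]
  intro e he
  obtain ⟨δ, hδ, hδe⟩ : ∃ δ : ℝ, 0 < δ ∧ ENNReal.ofReal δ ≤ e := by
    rcases eq_or_ne e ∞ with rfl | hne
    · exact ⟨1, one_pos, le_top⟩
    · exact ⟨e.toReal, ENNReal.toReal_pos he.ne' hne, (ENNReal.ofReal_toReal hne).le⟩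
  -- Dividing by `D + 1` instead of `D` also covers `D = 0`.
  filter_upwards [hW τ x (δ / (D + 1)) (by positivity) (h _ (by positivity))] with R hR
  refine hR.trans (le_trans (ENNReal.ofReal_le_ofReal ?_) hδe)
  rw [mul_div_assoc', div_le_iff₀ (by positivity)]
  nlinarith

theorem LocalKernel.eventually_le {W : ℝ → ℝ → ℝ} (hW : LocalKernel W) {τ : Measure Boundary}
    [IsFiniteMeasure τ] {x : Boundary} (h : LinearGrowth τ x) :
    ∃ C : ℝ, ∀ᶠ R in 𝓝[>] 0, ∫⁻ y, ENNReal.ofReal (W R (dist y x)) ∂τ ≤ ENNReal.ofReal C := by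
  obtain ⟨D, -, hW⟩ := hW
  obtain ⟨M, hM, r₀, hr₀, h⟩ := h
  refine ⟨_, hW τ x (M + 1) (by positivity) ⟨r₀, hr₀, fun r hr hr' => (h r hr hr').trans ?_⟩⟩
  apply ENNReal.ofReal_le_ofReal
  nlinarith

theorem LocalKernel.add {W V : ℝ → ℝ → ℝ} (hW : LocalKernel W) (hV : LocalKernel V)
    (hm : ∀ R, Measurable (W R)) : LocalKernel fun R d => W R d + V R d := by
  obtain ⟨D, hD, hW⟩ := hW
  obtain ⟨D', hD', hV⟩ := hV
  refine ⟨D + D', by positivity, fun τ _ x ε hε h => ?_⟩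
  filter_upwards [hW τ x ε hε h, hV τ x ε hε h] with R h1 h2
  calc _ ≤ ∫⁻ y, (ENNReal.ofReal (W R (dist y x)) + ENNReal.ofReal (V R (dist y x))) ∂τ :=
        lintegral_mono fun y => ENNReal.ofReal_add_le
    _ ≤ ENNReal.ofReal (D * ε) + ENNReal.ofReal (D' * ε) := by
        have : Measurable fun y => ENNReal.ofReal (W R (dist y x)) :=
          ((hm R).comp (measurable_id.dist measurable_const)).ennreal_ofReal
        rw [lintegral_add_left this]
        exact add_le_add h1 h2
    _ = _ := by rw [← ENNReal.ofReal_add (by positivity) (by positivity), add_mul]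

theorem localKernel_indicator {c : ℝ} (hc : 0 < c) :
    LocalKernel fun R d => (Iic (c * R)).indicator (fun _ => R⁻¹) d := by
  refine ⟨c, hc.le, fun τ _ x ε hε ⟨r₀, hr₀, h⟩ => ?_⟩
  have : Ioc (0 : ℝ) (r₀ / c) ∈ 𝓝[>] (0 : ℝ) := Ioc_mem_nhdsGT (by positivity)
  filter_upwards [this] with R hR
  have hR0 : 0 < R := hR.1
  calc _ = ∫⁻ y, (closedBall x (c * R)).indicator (fun _ => ENNReal.ofReal R⁻¹) y ∂τ := by
        refine lintegral_congr fun y => ?_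
        by_cases hy : dist y x ≤ c * R
        · rw [indicator_of_mem (by exact hy), indicator_of_mem (by exact hy)]
        · rw [indicator_of_notMem (by exact hy), indicator_of_notMem (by exact hy),
            ENNReal.ofReal_zero]
    _ = ENNReal.ofReal R⁻¹ * τ (closedBall x (c * R)) := by
        rw [lintegral_indicator measurableSet_closedBall, setLIntegral_const]
    _ ≤ ENNReal.ofReal R⁻¹ * ENNReal.ofReal (ε * (c * R)) := by
        gcongr
        refine h _ (by positivity) ?_
        have := hR.2
        rw [le_div_iff₀ hc] at this
        linarith
    _ = _ := by
        rw [← ENNReal.ofReal_mul (by positivity)]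
        congr 1
        field_simp

/-- Layer-cake formula: the set where the kernel is at least `u` lies in the ball of radius `u ^
(-1/α)`. Levels below `r₀ ^ (-α)` are bounded by the total mass, levels up to `R ^ (-α)` by the
growth hypothesis, and higher levels are not attained. -/
theorem lintegral_rpow_dist_le {τ : Measure Boundary} {x : Boundary} {ε r₀ α R : ℝ}
    (hε : 0 < ε) (hα : 0 < α) (hR : 0 < R) (hRr : R ≤ r₀)
    (h : ∀ r, 0 < r → r ≤ r₀ → τ (closedBall x r) ≤ ENNReal.ofReal (ε * r)) :
    ∫⁻ y, ENNReal.ofReal ((max R (dist y x)) ^ (-α)) ∂τ ≤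
      ENNReal.ofReal (r₀ ^ (-α)) * τ univ +
        ENNReal.ofReal (ε * ∫ u in (r₀ ^ (-α))..(R ^ (-α)), u ^ (-α⁻¹)) := by
  have hr₀ : 0 < r₀ := hR.trans_le hRr
  have ha : 0 < r₀ ^ (-α) := by positivity
  have hab : r₀ ^ (-α) ≤ R ^ (-α) := Real.rpow_le_rpow_of_nonpos hR hRr (by linarith)
  have hcont : Continuous fun y : Boundary => (max R (dist y x)) ^ (-α) := by
    refine Continuous.rpow_const (by fun_prop) fun y => Or.inl ?_
    exact (lt_max_of_lt_left hR).ne'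
  rw [lintegral_eq_lintegral_meas_le τ (Eventually.of_forall fun y => by positivity)
    hcont.measurable.aemeasurable]
  have hset {u : ℝ} (hu : 0 < u) (y : Boundary) :
      u ≤ (max R (dist y x)) ^ (-α) ↔ max R (dist y x) ≤ u ^ (-α⁻¹) := by
    have hm : 0 < max R (dist y x) := lt_max_of_lt_left hR
    rw [← inv_neg, Real.le_rpow_inv_iff_of_neg hm hu (by linarith)]
  have hsplit : Ioi (0 : ℝ) = Ioc 0 (r₀ ^ (-α)) ∪ (Ioc (r₀ ^ (-α)) (R ^ (-α)) ∪ Ioi (R ^ (-α))) := by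
    rw [Ioc_union_Ioi_eq_Ioi hab, Ioc_union_Ioi_eq_Ioi ha.le]
  have h1 : ∫⁻ u in Ioc 0 (r₀ ^ (-α)), τ {y | u ≤ (max R (dist y x)) ^ (-α)} ≤
      ENNReal.ofReal (r₀ ^ (-α)) * τ univ := by
    refine (setLIntegral_mono measurable_const fun u _ => measure_mono (subset_univ _)).trans ?_
    rw [setLIntegral_const, Real.volume_Ioc, sub_zero, mul_comm]
  have h2 : ∫⁻ u in Ioc (r₀ ^ (-α)) (R ^ (-α)), τ {y | u ≤ (max R (dist y x)) ^ (-α)} ≤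
      ENNReal.ofReal (ε * ∫ u in (r₀ ^ (-α))..(R ^ (-α)), u ^ (-α⁻¹)) := by
    have hpos : ∀ u ∈ Ioc (r₀ ^ (-α)) (R ^ (-α)), 0 < u := fun u hu => ha.trans hu.1
    calc _ ≤ ∫⁻ u in Ioc (r₀ ^ (-α)) (R ^ (-α)), ENNReal.ofReal (ε * u ^ (-α⁻¹)) := by
          refine setLIntegral_mono' measurableSet_Ioc fun u hu => ?_
          have hu0 := hpos u hu
          refine le_trans (measure_mono fun y hy => ?_) (h (u ^ (-α⁻¹)) (by positivity) ?_)
          · exact (le_max_right _ _).trans ((hset hu0 y).1 hy)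
          · rw [← inv_neg, Real.rpow_inv_le_iff_of_neg hu0 hr₀ (by linarith)]
            exact hu.1.le
      _ = _ := by
          rw [← intervalIntegral.integral_const_mul, intervalIntegral.integral_of_le hab,
            ofReal_integral_eq_lintegral_ofReal]
          · have : ContinuousOn (fun u : ℝ => ε * u ^ (-α⁻¹)) (Icc (r₀ ^ (-α)) (R ^ (-α))) := by
              refine continuousOn_const.mul (continuousOn_id.rpow_const fun u hu => Or.inl ?_)
              exact (ha.trans_le hu.1).ne'
            exact this.integrableOn_Icc.mono_set Ioc_subset_Icc_self
          · filter_upwards [self_mem_ae_restrict measurableSet_Ioc] with u hu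
            have := hpos u hu
            positivity
  have h3 : ∫⁻ u in Ioi (R ^ (-α)), τ {y | u ≤ (max R (dist y x)) ^ (-α)} = 0 := by
    rw [setLIntegral_congr_fun (g := fun _ => 0) measurableSet_Ioi, lintegral_zero]
    intro u hu
    simp only
    rw [← measure_empty (μ := τ)]
    congr 1
    ext y
    simp only [mem_ofPred_eq, mem_empty_iff_false, iff_false, not_le]
    exact (Real.rpow_le_rpow_of_nonpos hR (le_max_left _ _) (by linarith)).trans_lt hu
  rw [hsplit]
  refine (lintegral_union_le _ _ _).trans (add_le_add h1 ?_)
  refine (lintegral_union_le _ _ _).trans ?_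
  rw [h3, add_zero]
  exact h2

/-- The factor `R ^ β` makes the total-mass term vanish as `R → 0`, and it exactly cancels the
growth `R ^ (-β)` of the local term. These account for the summands `1` and `(1 + β) / β` of the
constant. -/
theorem localKernel_rpow {β : ℝ} (hβ : 0 < β) :
    LocalKernel fun R d => R ^ β * (max R d) ^ (-(1 + β)) := by
  refine ⟨1 + (1 + β) / β, by positivity, fun τ _ x ε hε ⟨r₀, hr₀, h⟩ => ?_⟩
  have h1 : Tendsto (fun R : ℝ => R ^ β * (r₀ ^ (-(1 + β)) * τ.real univ)) (𝓝[>] 0) (𝓝 0) := by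
    have : Tendsto (fun R : ℝ => R ^ β) (𝓝[>] 0) (𝓝 (0 ^ β)) :=
      ((Real.continuous_rpow_const hβ.le).tendsto 0).mono_left nhdsWithin_le_nhds
    rw [Real.zero_rpow hβ.ne'] at this
    simpa using this.mul_const (r₀ ^ (-(1 + β)) * τ.real univ)
  filter_upwards [h1.eventually_le_const hε, Ioc_mem_nhdsGT hr₀] with R hR1 hR
  have hR0 : 0 < R := hR.1
  have key := lintegral_rpow_dist_le (α := 1 + β) hε (by positivity) hR.1 hR.2 h
  calc _ = ENNReal.ofReal (R ^ β) *
        ∫⁻ y, ENNReal.ofReal ((max R (dist y x)) ^ (-(1 + β))) ∂τ := by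
        rw [← lintegral_const_mul' _ _ ENNReal.ofReal_ne_top]
        refine lintegral_congr fun y => ENNReal.ofReal_mul (by positivity)
    _ ≤ ENNReal.ofReal (R ^ β) * (ENNReal.ofReal (r₀ ^ (-(1 + β))) * τ univ +
        ENNReal.ofReal (ε * ∫ u in (r₀ ^ (-(1 + β)))..(R ^ (-(1 + β))), u ^ (-(1 + β)⁻¹))) := by
        gcongr
    _ ≤ ENNReal.ofReal ε + ENNReal.ofReal ((1 + β) / β * ε) := by
        rw [mul_add]
        refine add_le_add ?_ ?_
        · rw [← ofReal_measureReal (μ := τ) (s := univ), ← ENNReal.ofReal_mul (by positivity),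
            ← ENNReal.ofReal_mul (by positivity)]
          exact ENNReal.ofReal_le_ofReal hR1
        · rw [← ENNReal.ofReal_mul (by positivity)]
          apply ENNReal.ofReal_le_ofReal
          have hb : -(1 + β)⁻¹ + 1 = β / (1 + β) := by field_simp; ring
          have hp : 0 < β / (1 + β) := by positivity
          rw [integral_rpow (Or.inl (by linarith)), hb]
          have e1 : (R ^ (-(1 + β))) ^ (β / (1 + β)) = R ^ (-β) := by
            rw [← Real.rpow_mul hR0.le]
            congr 1
            field_simp
          rw [e1]
          have e2 : R ^ β * R ^ (-β) = 1 := by rw [← Real.rpow_add hR0]; simp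
          have e3 : 0 ≤ (r₀ ^ (-(1 + β))) ^ (β / (1 + β)) := by positivity
          calc _ ≤ R ^ β * (ε * (R ^ (-β) / (β / (1 + β)))) := by gcongr; linarith
            _ = (R ^ β * R ^ (-β)) * ((1 + β) / β * ε) := by field_simp
            _ = _ := by rw [e2, one_mul]
    _ = _ := by
        rw [← ENNReal.ofReal_add hε.le (by positivity)]
        congr 1
        ring

/-- The borderline exponent `β = 0`: the local term is now the integral of `u⁻¹`, which grows like
`log R⁻¹`, and this is the normalisation. -/
theorem localKernel_log :
    LocalKernel fun R d => (Real.log R⁻¹)⁻¹ * (max R d)⁻¹ := by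
  refine ⟨2, by positivity, fun τ _ x ε hε ⟨r₁, hr₁, h⟩ => ?_⟩
  -- With `r₀ ≤ 1` the term `log r₀⁻¹` is nonnegative and can be dropped from `log R⁻¹ - log r₀⁻¹`.
  obtain ⟨r₀, hr₀, hr₀1, h⟩ : ∃ r₀ > 0, r₀ ≤ 1 ∧ ∀ r, 0 < r → r ≤ r₀ →
      τ (closedBall x r) ≤ ENNReal.ofReal (ε * r) :=
    ⟨min r₁ 1, lt_min hr₁ one_pos, min_le_right _ _,
      fun r hr hr' => h r hr (hr'.trans (min_le_left _ _))⟩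
  have hlog : Tendsto (fun R : ℝ => Real.log R⁻¹) (𝓝[>] 0) atTop :=
    Real.tendsto_log_atTop.comp tendsto_inv_nhdsGT_zero
  have h1 : Tendsto (fun R : ℝ => (Real.log R⁻¹)⁻¹ * (r₀⁻¹ * τ.real univ)) (𝓝[>] 0) (𝓝 0) := by
    simpa using (tendsto_inv_atTop_zero.comp hlog).mul_const (r₀⁻¹ * τ.real univ)
  filter_upwards [h1.eventually_le_const hε, Ioc_mem_nhdsGT hr₀,
    hlog.eventually_gt_atTop 0] with R hR1 hR hL
  have hR0 : 0 < R := hR.1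
  have key := lintegral_rpow_dist_le (α := 1) hε one_pos hR.1 hR.2 h
  simp only [Real.rpow_neg_one, inv_one] at key
  calc _ = ENNReal.ofReal (Real.log R⁻¹)⁻¹ * ∫⁻ y, ENNReal.ofReal ((max R (dist y x))⁻¹) ∂τ := by
        rw [← lintegral_const_mul' _ _ ENNReal.ofReal_ne_top]
        refine lintegral_congr fun y => ENNReal.ofReal_mul (by positivity)
    _ ≤ ENNReal.ofReal (Real.log R⁻¹)⁻¹ * (ENNReal.ofReal r₀⁻¹ * τ univ +
        ENNReal.ofReal (ε * ∫ u in r₀⁻¹..R⁻¹, u⁻¹)) := by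
        gcongr
    _ ≤ ENNReal.ofReal ε + ENNReal.ofReal ε := by
        rw [mul_add]
        refine add_le_add ?_ ?_
        · rw [← ofReal_measureReal (μ := τ) (s := univ), ← ENNReal.ofReal_mul (by positivity),
            ← ENNReal.ofReal_mul (by positivity)]
          exact ENNReal.ofReal_le_ofReal hR1
        · rw [← ENNReal.ofReal_mul (by positivity)]
          apply ENNReal.ofReal_le_ofReal
          rw [integral_inv_of_pos (by positivity) (by positivity),
            Real.log_div (by positivity) (by positivity), inv_mul_le_iff₀ hL]
          have : 0 ≤ Real.log r₀⁻¹ := Real.log_nonneg (one_le_inv_iff₀.2 ⟨hr₀, hr₀1⟩)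
          nlinarith
    _ = _ := by rw [← ENNReal.ofReal_add hε.le hε.le, two_mul]

/-! ### Approach regions -/

theorem tendsto_one_sub_norm {S : Set ℂ} (hS : S ⊆ ball (0 : ℂ) 1) (ξ : Boundary) :
    Tendsto (fun z : ℂ => 1 - ‖z‖) (𝓝[S] (ξ : ℂ)) (𝓝[>] 0) := by
  refine tendsto_nhdsWithin_iff.2 ⟨?_, ?_⟩
  · have : Tendsto (fun z : ℂ => 1 - ‖z‖) (𝓝 (ξ : ℂ)) (𝓝 (1 - ‖(ξ : ℂ)‖)) :=
      (by fun_prop : Continuous fun z : ℂ => 1 - ‖z‖).tendsto _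
    have hξ : ‖(ξ : ℂ)‖ = 1 := by simp
    rw [hξ, sub_self] at this
    exact this.mono_left nhdsWithin_le_nhds
  · filter_upwards [self_mem_nhdsWithin] with z hz
    have := hS hz
    rw [mem_ball_zero_iff] at this
    simpa using this

theorem norm_one_sub_mul_conj_sq (z w : ℂ) :
    ‖1 - z * conj w‖ ^ 2 - ‖z - w‖ ^ 2 = (1 - ‖z‖ ^ 2) * (1 - ‖w‖ ^ 2) := by
  simp only [← Complex.normSq_eq_norm_sq, Complex.normSq_apply]
  simp
  ring

/-- For a nearby `w` on the radius, `v + u ≤ E (v - u)` gives `(v + u)² ≤ E (v² - u²) ≤ 4E (1 -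
|z|)(1 - |w|)`. As `v ≥ 1 - |w|`, first `1 - |w|` and then `u = |z - w|` are at most `4E (1 - |z|)`;
their sum bounds `|z - ξ|`. -/
theorem norm_sub_le_of_distToRadius_le {z : ℂ} {ξ : Boundary} {b : ℝ} (hz : ‖z‖ < 1)
    (h : distToRadius z ξ ≤ b) : ‖z - ξ‖ ≤ 8 * Real.exp (b + 1) * (1 - ‖z‖) := by
  have hξ : ‖(ξ : ℂ)‖ = 1 := by simp
  have hne : (hypDist z '' (segment ℝ 0 (ξ : ℂ) ∩ ball (0 : ℂ) 1)).Nonempty :=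
    ⟨_, 0, ⟨left_mem_segment ℝ _ _, by simp⟩, rfl⟩
  -- The increment from `b` to `b + 1` avoids showing that the infimum is attained.
  obtain ⟨_, ⟨w, ⟨hw, hw1⟩, rfl⟩, hwb⟩ := exists_lt_of_csInf_lt hne (h.trans_lt (lt_add_one b))
  rw [mem_ball_zero_iff] at hw1
  have hwξ : ‖w - ξ‖ = 1 - ‖w‖ := by
    rw [segment_eq_image] at hw
    obtain ⟨x, hx, rfl⟩ := hw
    simp only [smul_zero, zero_add] at *
    have e : x • (ξ : ℂ) - ξ = (x - 1) • (ξ : ℂ) := by rw [sub_smul, one_smul]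
    rw [e, norm_smul, norm_smul, hξ, mul_one, mul_one, Real.norm_eq_abs, Real.norm_eq_abs,
      abs_of_nonneg hx.1, abs_of_nonpos (by linarith [hx.2])]
    ring
  set u := ‖z - w‖
  set v := ‖1 - z * conj w‖
  set E := Real.exp (b + 1)
  have hE : 0 < E := Real.exp_pos _
  have hu : 0 ≤ u := norm_nonneg _
  have hid : v ^ 2 - u ^ 2 = (1 - ‖z‖ ^ 2) * (1 - ‖w‖ ^ 2) := norm_one_sub_mul_conj_sq z w
  have hz0 := norm_nonneg z
  have hw0 := norm_nonneg w
  have hv0 : 1 - ‖w‖ ≤ v := by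
    have h1 : ‖(1 : ℂ)‖ - ‖z * conj w‖ ≤ v := norm_sub_norm_le _ _
    rw [norm_one, norm_mul, RCLike.norm_conj] at h1
    nlinarith
  have hpos : 0 < (1 - ‖z‖ ^ 2) * (1 - ‖w‖ ^ 2) := by apply mul_pos <;> nlinarith
  have hvu : 0 < v - u := by nlinarith
  have hratio : v + u ≤ E * (v - u) := by
    rw [← div_le_iff₀ hvu, ← Real.log_le_iff_le_exp (by apply div_pos <;> linarith)]
    exact hwb.le
  have hsq : (v + u) ^ 2 ≤ E * ((1 - ‖z‖ ^ 2) * (1 - ‖w‖ ^ 2)) := by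
    rw [← hid]; nlinarith
  have hsq2 : (v + u) ^ 2 ≤ 4 * E * (1 - ‖z‖) * (1 - ‖w‖) := by
    refine hsq.trans ?_
    have : (1 - ‖z‖ ^ 2) * (1 - ‖w‖ ^ 2) ≤ 4 * ((1 - ‖z‖) * (1 - ‖w‖)) := by
      have h2 : 0 ≤ (1 - ‖z‖) * (1 - ‖w‖) := mul_nonneg (by linarith) (by linarith)
      have h3 : (1 + ‖z‖) * (1 + ‖w‖) ≤ 4 := by nlinarith
      calc _ = (1 + ‖z‖) * (1 + ‖w‖) * ((1 - ‖z‖) * (1 - ‖w‖)) := by ring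
        _ ≤ _ := mul_le_mul_of_nonneg_right h3 h2
    nlinarith
  have hw2 : 1 - ‖w‖ ≤ 4 * E * (1 - ‖z‖) := by
    have h1 : (1 - ‖w‖) * (1 - ‖w‖) ≤ 4 * E * (1 - ‖z‖) * (1 - ‖w‖) := by nlinarith
    exact le_of_mul_le_mul_right h1 (by linarith)
  have hu2 : u ≤ 4 * E * (1 - ‖z‖) := by
    have h0 : 0 ≤ 4 * E * (1 - ‖z‖) := mul_nonneg (by positivity) (by linarith)
    refine abs_le_of_sq_le_sq' ?_ h0 |>.2
    nlinarith
  calc ‖z - ξ‖ ≤ ‖z - w‖ + ‖w - ξ‖ := norm_sub_le_norm_sub_add_norm_sub _ _ _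
    _ ≤ _ := by rw [hwξ]; linarith

theorem hypDist_zero (z : ℂ) : hypDist z 0 = Real.log ((1 + ‖z‖) / (1 - ‖z‖)) := by
  simp [hypDist]

/-- The logarithm in the width becomes, after exponentiation, the factor `hypDist z 0`, which is at
most `2 log (1 - ‖z‖)⁻¹`. -/
theorem norm_sub_le_of_mem_enlargedRegion {z : ℂ} {ξ : Boundary} {a : ℝ}
    (h : z ∈ enlargedRegion a ξ) (ht : 1 - ‖z‖ ≤ 1 / 2) :
    ‖z - ξ‖ ≤ 16 * Real.exp (a + 1) * ((1 - ‖z‖) * Real.log (1 - ‖z‖)⁻¹) := by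
  obtain ⟨hz, h⟩ := h
  rw [mem_ball_zero_iff] at hz
  have ht0 : 0 < 1 - ‖z‖ := by linarith
  have hh0 : 0 < hypDist z 0 := by
    rw [hypDist_zero]
    apply Real.log_pos
    rw [lt_div_iff₀ ht0]
    linarith
  have hh : hypDist z 0 ≤ 2 * Real.log (1 - ‖z‖)⁻¹ := by
    rw [hypDist_zero, ← Real.log_rpow (by positivity)]
    apply Real.log_le_log (by positivity)
    norm_num
    rw [div_le_iff₀ ht0, ← inv_pow, pow_two, mul_assoc, inv_mul_cancel₀ ht0.ne', mul_one,
      ← one_div, le_div_iff₀ ht0]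
    nlinarith
  have := norm_sub_le_of_distToRadius_le hz h
  rw [show a + Real.log (hypDist z 0) + 1 = (a + 1) + Real.log (hypDist z 0) by ring,
    Real.exp_add, Real.exp_log hh0] at this
  refine this.trans ?_
  have he := Real.exp_pos (a + 1)
  calc _ ≤ 8 * (Real.exp (a + 1) * (2 * Real.log (1 - ‖z‖)⁻¹)) * (1 - ‖z‖) := by gcongr
    _ = _ := by ring

/-- Near the boundary `hypDist z 0 ≥ 1`, so the additional width is nonnegative. -/
theorem mem_enlargedRegion_of_mem_admissibleRegion {z : ℂ} {ξ : Boundary} {a : ℝ}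
    (h : z ∈ admissibleRegion a ξ) (ht : 1 - ‖z‖ ≤ Real.exp (-1)) (ht' : 1 - ‖z‖ ≤ 1 / 2) :
    z ∈ enlargedRegion a ξ := by
  refine ⟨h.1, h.2.trans ?_⟩
  have hz := h.1
  rw [mem_ball_zero_iff] at hz
  have ht0 : 0 < 1 - ‖z‖ := by linarith
  have : 1 ≤ hypDist z 0 := by
    rw [hypDist_zero, Real.le_log_iff_exp_le (by apply div_pos <;> linarith), le_div_iff₀ ht0]
    rw [Real.exp_neg] at ht
    have h2 : Real.exp 1 * (1 - ‖z‖) ≤ 1 := by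
      calc _ ≤ Real.exp 1 * (Real.exp 1)⁻¹ := by gcongr
        _ = 1 := mul_inv_cancel₀ (Real.exp_pos _).ne'
    linarith
  linarith [Real.log_nonneg this]

/-! ### Polyspherical functions as radial integrals -/

open Classical in
/-- The function of the Poisson kernel defining `polyKernel`. -/
noncomputable def polyProfile (lam : ℂ) (n : ℕ) (p : ℝ) : ℂ :=
  if lam = -1 / 4 then
    1 / ((2 * n).factorial : ℂ) * ((-Real.log p : ℝ) : ℂ) ^ (2 * n) * (p : ℂ) ^ (1 / 2 : ℂ)
  else
    1 / ((n.factorial : ℂ) * (2 * rootParam lam) ^ n) * (-((-Real.log p : ℝ) : ℂ)) ^ n *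
      (p : ℂ) ^ (rootParam lam + 1 / 2)

theorem polyKernel_eq_polyProfile (lam : ℂ) (n : ℕ) (z : ℂ) (ξ : Boundary) :
    polyKernel lam n z ξ = polyProfile lam n (poissonKernel z ξ) := rfl

/-- The Poisson kernel at distance `t` from the boundary and angle `θ`. -/
noncomputable def angularPoisson (t θ : ℝ) : ℝ :=
  t * (2 - t) / (t ^ 2 + 4 * (1 - t) * Real.sin (θ / 2) ^ 2)

theorem poissonKernel_boundaryPoint (z : ℂ) (θ : ℝ) :
    poissonKernel z (boundaryPoint θ) = angularPoisson (1 - ‖z‖) (θ - Complex.arg z) := by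
  have h : ‖(boundaryPoint θ : ℂ) - z‖ ^ 2 =
      (1 - ‖z‖) ^ 2 + 4 * (1 - (1 - ‖z‖)) * Real.sin ((θ - Complex.arg z) / 2) ^ 2 := by
    have e : (boundaryPoint θ : ℂ) - z = Complex.exp (Complex.arg z * Complex.I) *
        (Complex.exp ((θ - Complex.arg z : ℝ) * Complex.I) - ‖z‖) := by
      conv_lhs => rw [← Complex.norm_mul_exp_arg_mul_I z]
      rw [mul_sub, ← Complex.exp_add, boundaryPoint]
      push_cast
      congr 1
      · congr 1; ring
      · ring
    have hc := Real.cos_sq' ((θ - Complex.arg z) / 2)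
    have hd := Real.cos_two_mul ((θ - Complex.arg z) / 2)
    rw [mul_div_cancel₀ _ (two_ne_zero)] at hd
    rw [e, norm_mul, Complex.norm_exp_ofReal_mul_I, one_mul, ← Complex.normSq_eq_norm_sq,
      Complex.normSq_apply, Complex.sub_re, Complex.sub_im, Complex.exp_ofReal_mul_I_re,
      Complex.exp_ofReal_mul_I_im, Complex.ofReal_re, Complex.ofReal_im, sub_zero]
    have hs := Real.sin_sq_add_cos_sq (θ - Complex.arg z)
    linear_combination hs - 2 * ‖z‖ * hd - 4 * ‖z‖ * hc
  rw [poissonKernel, h, angularPoisson]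
  congr 1
  ring

theorem angularPoisson_periodic (t : ℝ) :
    Function.Periodic (angularPoisson t) (2 * Real.pi) := by
  intro θ
  rw [angularPoisson, show (θ + 2 * Real.pi) / 2 = θ / 2 + Real.pi by ring, Real.sin_add_pi, neg_sq,
    angularPoisson]

theorem continuous_poissonKernel {z : ℂ} (hz : ‖z‖ < 1) : Continuous (poissonKernel z) := by
  unfold poissonKernel
  refine continuous_const.div (by fun_prop) fun ξ h => ?_
  have := poissonKernel_pos hz ξ
  rw [poissonKernel, h, div_zero] at this
  exact this.false

theorem continuousOn_polyProfile (lam : ℂ) (n : ℕ) :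
    ContinuousOn (polyProfile lam n) (Ioi 0) := by
  have h1 : ContinuousOn (fun p : ℝ => ((-Real.log p : ℝ) : ℂ)) (Ioi 0) :=
    Complex.continuous_ofReal.comp_continuousOn
      (Real.continuousOn_log.mono fun p (hp : 0 < p) => hp.ne').neg
  have h2 (w : ℂ) : ContinuousOn (fun p : ℝ => (p : ℂ) ^ w) (Ioi 0) :=
    Complex.continuous_ofReal.continuousOn.cpow_const fun p hp =>
      Complex.ofReal_mem_slitPlane.2 hp
  unfold polyProfile
  split_ifs
  · exact (continuousOn_const.mul (h1.pow _)).mul (h2 _)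
  · exact (continuousOn_const.mul (h1.neg.pow _)).mul (h2 _)

theorem continuous_polyKernel (lam : ℂ) (n : ℕ) {z : ℂ} (hz : ‖z‖ < 1) :
    Continuous (polyKernel lam n z) :=
  (continuousOn_polyProfile lam n).comp_continuous (continuous_poissonKernel hz)
    fun ξ => poissonKernel_pos hz ξ

/-- The argument of `z` only translates a `2π`-periodic integrand, so it disappears. -/
theorem polyspherical_eq {z : ℂ} (hz : ‖z‖ < 1) (lam : ℂ) (n : ℕ) :
    polyspherical lam n z = ((1 / (2 * Real.pi) : ℝ) : ℂ) *
      ∫ θ in (-Real.pi)..Real.pi, polyProfile lam n (angularPoisson (1 - ‖z‖) θ) := by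
  have hpi := Real.pi_pos
  rw [polyspherical, arcMeasure, integral_smul_measure, integral_map
    continuous_boundaryPoint.aemeasurable (continuous_polyKernel lam n hz).aestronglyMeasurable,
    ENNReal.toReal_ofReal (by positivity), Complex.real_smul]
  congr 1
  rw [← intervalIntegral.integral_of_le (by linarith)]
  simp only [polyKernel_eq_polyProfile, poissonKernel_boundaryPoint]
  have hper : Function.Periodic (fun θ => polyProfile lam n (angularPoisson (1 - ‖z‖) θ))
      (2 * Real.pi) := fun θ => by simp only [angularPoisson_periodic (1 - ‖z‖) θ]
  rw [intervalIntegral.integral_comp_sub_right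
    (fun θ => polyProfile lam n (angularPoisson (1 - ‖z‖) θ))]
  have h := hper.intervalIntegral_add_eq (-Real.pi - Complex.arg z) (-Real.pi)
  rw [show -Real.pi - Complex.arg z + 2 * Real.pi = Real.pi - Complex.arg z by ring,
    show -Real.pi + 2 * Real.pi = Real.pi by ring] at h
  exact h

/-! ### Bounds for the Poisson kernel -/

theorem angularPoisson_denom_pos {t θ : ℝ} (ht : 0 < t) (ht' : t ≤ 1) :
    0 < t ^ 2 + 4 * (1 - t) * Real.sin (θ / 2) ^ 2 := by
  have : 0 ≤ 4 * (1 - t) * Real.sin (θ / 2) ^ 2 := mul_nonneg (by linarith) (sq_nonneg _)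
  positivity

theorem angularPoisson_pos {t θ : ℝ} (ht : 0 < t) (ht' : t ≤ 1) : 0 < angularPoisson t θ :=
  div_pos (mul_pos ht (by linarith)) (angularPoisson_denom_pos ht ht')

theorem continuous_angularPoisson {t : ℝ} (ht : 0 < t) (ht' : t ≤ 1) :
    Continuous (angularPoisson t) :=
  continuous_const.div (by fun_prop) fun _ => (angularPoisson_denom_pos ht ht').ne'

/-- For `t ≤ 1/4` the terms `log 4` and `log 2` are absorbed by a second `log t⁻¹`. -/
theorem abs_log_le_of_le_of_le {t p : ℝ} (ht : 0 < t) (ht' : t ≤ 1 / 4) (h1 : t / 4 ≤ p)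
    (h2 : p ≤ 2 / t) : |Real.log p| ≤ 2 * Real.log t⁻¹ := by
  have hp : 0 < p := lt_of_lt_of_le (by positivity) h1
  have h4 : Real.log 4 ≤ Real.log t⁻¹ := by
    apply Real.log_le_log (by norm_num)
    rw [le_inv_comm₀ (by norm_num) ht]
    linarith
  have h24 : Real.log 2 ≤ Real.log 4 := Real.log_le_log (by norm_num) (by norm_num)
  have e1 := Real.log_le_log (by positivity) h1
  have e2 := Real.log_le_log hp h2
  rw [Real.log_div ht.ne' (by norm_num)] at e1
  rw [Real.log_div (by norm_num) ht.ne'] at e2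
  rw [Real.log_inv] at *
  rw [abs_le]
  constructor <;> linarith

theorem angularPoisson_bounds {t : ℝ} (ht : 0 < t) (ht' : t ≤ 1) (θ : ℝ) :
    t / 4 ≤ angularPoisson t θ ∧ angularPoisson t θ ≤ 2 / t := by
  have hs := Real.sin_sq_le_one (θ / 2)
  have hs0 := sq_nonneg (Real.sin (θ / 2))
  constructor
  · rw [angularPoisson, div_le_div_iff₀ (by norm_num) (angularPoisson_denom_pos ht ht')]
    have : t ^ 2 + 4 * (1 - t) * Real.sin (θ / 2) ^ 2 ≤ (2 - t) * 4 := by nlinarith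
    nlinarith
  · rw [angularPoisson, div_le_div_iff₀ (angularPoisson_denom_pos ht ht') ht]
    nlinarith [mul_nonneg (sub_nonneg.2 ht') hs0, pow_pos ht 2, pow_pos ht 3]

theorem poissonKernel_bounds {z : ℂ} (hz : ‖z‖ < 1) (ξ : Boundary) :
    (1 - ‖z‖) / 4 ≤ poissonKernel z ξ ∧ poissonKernel z ξ ≤ 2 / (1 - ‖z‖) := by
  obtain ⟨θ, -, rfl⟩ := exists_boundaryPoint ξ
  rw [poissonKernel_boundaryPoint]
  exact angularPoisson_bounds (by linarith) (by linarith [norm_nonneg z]) _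

/-! ### The lower bound at the bottom of the spectrum -/

theorem polyProfile_bottom {p : ℝ} (hp : 0 < p) (n : ℕ) :
    polyProfile (-1 / 4) n p =
      ((1 / ((2 * n).factorial : ℝ) * Real.log p ^ (2 * n) * p ^ (1 / 2 : ℝ) : ℝ) : ℂ) := by
  rw [polyProfile, if_pos rfl]
  push_cast [Complex.ofReal_cpow hp.le]
  rw [Even.neg_pow (even_two_mul n)]

/-- The even power of the logarithm makes the integrand nonnegative, so the integral may be
restricted to `t ≤ θ ≤ t^(3/4)`. There it is at least a constant times `L^(2n) t^(1/2) / θ`, and `∫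
dθ/θ` supplies one more `L`. -/
theorem le_norm_polyspherical_bottom (n : ℕ) :
    ∃ c > 0, ∀ᶠ t in 𝓝[>] (0 : ℝ), ∀ z : ℂ, 1 - ‖z‖ = t →
      c * t ^ (1 / 2 : ℝ) * Real.log t⁻¹ ^ (2 * n + 1) ≤ ‖polyspherical (-1 / 4) n z‖ := by
  have hpi := Real.pi_pos
  set F : ℝ := ((2 * n).factorial : ℝ)
  have hF : 0 < F := by positivity
  refine ⟨1 / (2 * Real.pi) * (1 / F * (1 / 4) ^ (2 * n) * (1 / 2) * (1 / 4)), by positivity, ?_⟩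
  have hlog : Tendsto (fun R : ℝ => Real.log R⁻¹) (𝓝[>] 0) atTop :=
    Real.tendsto_log_atTop.comp tendsto_inv_nhdsGT_zero
  filter_upwards [Ioc_mem_nhdsGT (show (0 : ℝ) < 1 by norm_num),
    hlog.eventually_ge_atTop (4 * Real.log 2)] with t ht hL z hz
  obtain ⟨ht0, ht1⟩ := ht
  have hz1 : ‖z‖ < 1 := by linarith
  set L := Real.log t⁻¹
  have hL0 : 0 < L := lt_of_lt_of_le (by positivity) hL
  have hlt : Real.log t = -L := by simp [L]
  set g : ℝ → ℝ := fun θ => 1 / F * Real.log (angularPoisson t θ) ^ (2 * n) *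
    angularPoisson t θ ^ (1 / 2 : ℝ)
  have hq (θ : ℝ) : 0 < angularPoisson t θ := angularPoisson_pos ht0 ht1
  have hgc : Continuous g := by
    have := continuous_angularPoisson ht0 ht1
    refine (continuous_const.mul ((this.log fun θ => (hq θ).ne').pow _)).mul
      (this.rpow_const fun θ => Or.inl (hq θ).ne')
  have hg0 (θ : ℝ) : 0 ≤ g θ := by
    have := hq θ
    have := (even_two_mul n).pow_nonneg (Real.log (angularPoisson t θ))
    positivity
  have e : polyspherical (-1 / 4) n z =
      ((1 / (2 * Real.pi) * ∫ θ in (-Real.pi)..Real.pi, g θ : ℝ) : ℂ) := by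
    rw [polyspherical_eq hz1, hz, Complex.ofReal_mul, ← intervalIntegral.integral_ofReal]
    congr 1
    exact intervalIntegral.integral_congr fun θ _ => polyProfile_bottom (hq θ) n
  -- For `θ ≤ b` one has `log (t / (2θ²)) ≥ L/2 - log 2 ≥ L/4`, by `L ≥ 4 log 2`; also `log (b / t)
  -- = L/4`.
  set b := t ^ (3 / 4 : ℝ)
  have htb : t ≤ b := by
    conv_lhs => rw [← Real.rpow_one t]
    exact Real.rpow_le_rpow_of_exponent_ge ht0 ht1 (by norm_num)
  have hb1 : b ≤ 1 := Real.rpow_le_one ht0.le ht1 (by norm_num)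
  have hlb : Real.log b = -(3 / 4 * L) := by rw [Real.log_rpow ht0, hlt]; ring
  have hlow : ∀ θ ∈ Icc t b, 1 / F * (L / 4) ^ (2 * n) * (1 / 2 * t ^ (1 / 2 : ℝ)) * θ⁻¹ ≤ g θ := by
    intro θ hθ
    have hθ0 : 0 < θ := ht0.trans_le hθ.1
    have hsin : Real.sin (θ / 2) ^ 2 ≤ (θ / 2) ^ 2 := by
      rw [sq_le_sq]
      exact Real.abs_sin_le_abs
    have hqle : t / (2 * θ ^ 2) ≤ angularPoisson t θ := by
      rw [angularPoisson, div_le_div_iff₀ (by positivity) (angularPoisson_denom_pos ht0 ht1)]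
      have h1 : t ^ 2 + 4 * (1 - t) * Real.sin (θ / 2) ^ 2 ≤ 2 * θ ^ 2 := by
        have h2 : t ^ 2 ≤ θ ^ 2 := by nlinarith [hθ.1]
        nlinarith [sq_nonneg (Real.sin (θ / 2))]
      have h3 : t ≤ t * (2 - t) := by nlinarith
      calc _ ≤ t * (2 * θ ^ 2) := by gcongr
        _ ≤ _ := by gcongr
    have hlogq : L / 4 ≤ Real.log (angularPoisson t θ) := by
      refine le_trans ?_ (Real.log_le_log (by positivity) hqle)
      have h1 : Real.log θ ≤ -(3 / 4 * L) := hlb ▸ Real.log_le_log hθ0 hθ.2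
      rw [Real.log_div ht0.ne' (by positivity), Real.log_mul two_ne_zero (by positivity),
        Real.log_pow, hlt]
      push_cast
      linarith
    have hsqrt : 1 / 2 * t ^ (1 / 2 : ℝ) * θ⁻¹ ≤ angularPoisson t θ ^ (1 / 2 : ℝ) := by
      rw [← Real.sqrt_eq_rpow, ← Real.sqrt_eq_rpow]
      apply Real.le_sqrt_of_sq_le
      refine le_trans ?_ hqle
      rw [mul_pow, mul_pow, Real.sq_sqrt ht0.le, inv_pow]
      have : 0 < t * (θ ^ 2)⁻¹ := by positivity
      have e3 : t / (2 * θ ^ 2) = 1 / 2 * (t * (θ ^ 2)⁻¹) := by field_simp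
      rw [e3]
      linarith
    calc _ = 1 / F * (L / 4) ^ (2 * n) * (1 / 2 * t ^ (1 / 2 : ℝ) * θ⁻¹) := by ring
      _ ≤ _ := by
        have h0 : 0 ≤ 1 / 2 * t ^ (1 / 2 : ℝ) * θ⁻¹ := by positivity
        have h1 : (L / 4) ^ (2 * n) ≤ Real.log (angularPoisson t θ) ^ (2 * n) := by gcongr
        have h2 : 0 ≤ Real.log (angularPoisson t θ) ^ (2 * n) := le_trans (by positivity) h1
        simp only [g]
        gcongr
  have hint : 1 / F * (L / 4) ^ (2 * n) * (1 / 2 * t ^ (1 / 2 : ℝ)) * (L / 4) ≤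
      ∫ θ in (-Real.pi)..Real.pi, g θ := by
    calc _ = ∫ θ in t..b, 1 / F * (L / 4) ^ (2 * n) * (1 / 2 * t ^ (1 / 2 : ℝ)) * θ⁻¹ := by
          rw [intervalIntegral.integral_const_mul, integral_inv_of_pos ht0 (by positivity),
            Real.log_div (by positivity) ht0.ne', hlb, hlt]
          ring
      _ ≤ ∫ θ in t..b, g θ := by
          refine intervalIntegral.integral_mono_on htb ?_ (hgc.intervalIntegrable _ _) hlow
          refine (intervalIntegral.intervalIntegrable_inv (fun θ hθ => ?_)
            continuousOn_id).const_mul _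
          rw [uIcc_of_le htb] at hθ
          exact (ht0.trans_le hθ.1).ne'
      _ ≤ _ := by
          refine intervalIntegral.integral_mono_interval (by linarith) htb
            (by linarith [Real.pi_gt_three]) (Eventually.of_forall hg0) (hgc.intervalIntegrable _ _)
  rw [e, Complex.norm_real, Real.norm_eq_abs]
  refine le_trans (le_of_eq ?_) ((mul_le_mul_of_nonneg_left hint
    (by positivity : 0 ≤ 1 / (2 * Real.pi))).trans (le_abs_self _))
  rw [pow_succ, div_pow, div_pow]
  ring

/-! ### The lower bound above the bottom of the spectrum -/

theorem ofReal_cpow_eq_exp {y : ℝ} (hy : 0 < y) (w : ℂ) :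
    (y : ℂ) ^ w = Complex.exp ((Real.log y : ℂ) * w) := by
  rw [Complex.cpow_def_of_ne_zero (by exact_mod_cast hy.ne'), Complex.ofReal_log hy.le]

/-- Substitute `x = 1 / (1 + u²)`. -/
theorem betaIntegral_half_right (a : ℂ) :
    Complex.betaIntegral a (1 / 2) =
      2 * ∫ u in Ioi (0 : ℝ), (((1 + u ^ 2)⁻¹ : ℝ) : ℂ) ^ (a + 1 / 2) := by
  have himg : (fun u : ℝ => (1 + u ^ 2)⁻¹) '' Ioi 0 = Ioo 0 1 := by
    ext x
    constructor
    · rintro ⟨u, hu, rfl⟩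
      have hu0 : 0 < u := hu
      exact ⟨by positivity, inv_lt_one_of_one_lt₀ (by nlinarith)⟩
    · rintro ⟨h0, h1⟩
      have : 0 < x⁻¹ - 1 := by
        have := (one_lt_inv₀ h0).2 h1
        linarith
      refine ⟨Real.sqrt (x⁻¹ - 1), Real.sqrt_pos.2 this, ?_⟩
      simp only
      rw [Real.sq_sqrt this.le]
      simp
  have hinj : InjOn (fun u : ℝ => (1 + u ^ 2)⁻¹) (Ioi 0) := by
    intro u hu v hv h
    have hu0 : 0 < u := hu
    have hv0 : 0 < v := hv
    have h1 := inv_injective h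
    nlinarith
  have hderiv : ∀ u ∈ Ioi (0 : ℝ), HasDerivWithinAt (fun u : ℝ => (1 + u ^ 2)⁻¹)
      (-(2 * u) / (1 + u ^ 2) ^ 2) (Ioi 0) u := by
    intro u _
    have h1 : HasDerivAt (fun u : ℝ => 1 + u ^ 2) (2 * u) u := by
      simpa using (hasDerivAt_pow 2 u).const_add 1
    exact (h1.inv (by positivity)).hasDerivWithinAt
  rw [Complex.betaIntegral, intervalIntegral.integral_of_le zero_le_one,
    integral_Ioc_eq_integral_Ioo, ← himg,
    integral_image_eq_integral_abs_deriv_smul measurableSet_Ioi hderiv hinj, ← integral_const_mul]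
  refine setIntegral_congr_fun measurableSet_Ioi fun u hu => ?_
  have hu0 : 0 < u := hu
  have hy : 0 < 1 + u ^ 2 := by positivity
  have habs : |-(2 * u) / (1 + u ^ 2) ^ 2| = 2 * (u / (1 + u ^ 2) ^ 2) := by
    rw [abs_div, abs_neg, abs_of_pos (by positivity), abs_of_pos (by positivity)]
    ring
  have h1 : (1 : ℂ) - ((1 + u ^ 2)⁻¹ : ℝ) = ((u ^ 2 / (1 + u ^ 2) : ℝ) : ℂ) := by
    rw [← Complex.ofReal_one, ← Complex.ofReal_sub]
    congr 1
    field_simp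
    ring
  have h2 : ((u / (1 + u ^ 2) ^ 2 : ℝ) : ℂ) =
      Complex.exp ((Real.log (u / (1 + u ^ 2) ^ 2) : ℝ) : ℂ) := by
    rw [← Complex.ofReal_exp, Real.exp_log (by positivity)]
  simp only [habs]
  rw [Complex.real_smul, Complex.ofReal_mul, h1, ofReal_cpow_eq_exp (by positivity),
    ofReal_cpow_eq_exp (by positivity), ofReal_cpow_eq_exp (by positivity), h2, mul_assoc,
    ← Complex.exp_add, ← Complex.exp_add]
  push_cast
  congr 2
  rw [Real.log_div (by positivity) (by positivity), Real.log_div (by positivity) (by positivity),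
    Real.log_inv, Real.log_pow, Real.log_pow]
  push_cast
  ring

theorem integrable_inv_one_add_sq_cpow {w : ℂ} (hw : 1 / 2 < w.re) :
    Integrable fun u : ℝ => (((1 + u ^ 2)⁻¹ : ℝ) : ℂ) ^ w := by
  have h : Integrable fun u : ℝ => (1 + ‖u‖ ^ 2) ^ (-(2 * w.re) / 2) := by
    refine integrable_rpow_neg_one_add_norm_sq ?_
    simp only [Module.finrank_self, Nat.cast_one]
    linarith
  refine h.mono' (Continuous.aestronglyMeasurable ?_) (Eventually.of_forall fun u => ?_)
  · refine Continuous.cpow (Complex.continuous_ofReal.comp (Continuous.inv₀ (by fun_prop)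
      fun u => by positivity)) continuous_const fun u => Complex.ofReal_mem_slitPlane.2 ?_
    positivity
  · rw [Complex.norm_cpow_eq_rpow_re_of_pos (by positivity), Real.norm_eq_abs, sq_abs,
      show -(2 * w.re) / 2 = -w.re by ring, Real.rpow_neg (by positivity),
      Real.inv_rpow (by positivity)]

/-- Up to the factor `2 ^ w` this is the Beta integral `B(w - 1/2, 1/2)`, a quotient of Gamma
values. It cannot vanish, since Gamma has no zeros. -/
theorem integral_two_div_one_add_sq_cpow_ne_zero {w : ℂ} (hw : 1 / 2 < w.re) :
    ∫ u : ℝ, ((2 / (1 + u ^ 2) : ℝ) : ℂ) ^ w ≠ 0 := by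
  have hw' : 0 < (w - 1 / 2).re := by
    simp only [Complex.sub_re, Complex.div_ofNat_re, Complex.one_re]
    linarith
  have hb : Complex.betaIntegral (w - 1 / 2) (1 / 2) ≠ 0 := by
    intro h
    have h1 := Complex.Gamma_mul_Gamma_eq_betaIntegral hw' (t := 1 / 2) (by norm_num)
    rw [h, mul_zero] at h1
    exact mul_ne_zero (Complex.Gamma_ne_zero_of_re_pos hw')
      (Complex.Gamma_ne_zero_of_re_pos (by norm_num)) h1
  rw [betaIntegral_half_right, sub_add_cancel] at hb
  have h2 : ∫ u : ℝ, ((2 / (1 + u ^ 2) : ℝ) : ℂ) ^ w =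
      (2 : ℂ) ^ w * (2 * ∫ u in Ioi (0 : ℝ), (((1 + u ^ 2)⁻¹ : ℝ) : ℂ) ^ w) := by
    have e (u : ℝ) : ((2 / (1 + u ^ 2) : ℝ) : ℂ) ^ w =
        (2 : ℂ) ^ w * (((1 + u ^ 2)⁻¹ : ℝ) : ℂ) ^ w := by
      rw [div_eq_mul_inv, Complex.ofReal_mul,
        Complex.mul_cpow_ofReal_nonneg zero_le_two (by positivity), Complex.ofReal_ofNat]
    simp only [e]
    rw [integral_const_mul]
    congr 1
    have hint := integrable_inv_one_add_sq_cpow hw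
    have h3 := integral_comp_neg_Ioi 0 fun u : ℝ => (((1 + u ^ 2)⁻¹ : ℝ) : ℂ) ^ w
    simp only [even_two, Even.neg_pow, neg_zero] at h3
    rw [← intervalIntegral.integral_Iic_add_Ioi hint.integrableOn hint.integrableOn, ← h3, two_mul]
  rw [h2]
  exact mul_ne_zero (by simp [Complex.cpow_eq_zero_iff]) hb

/-- The rescaled Poisson kernel. -/
noncomputable def scaledPoisson (t u : ℝ) : ℝ := t * angularPoisson t (t * u)

theorem scaledPoisson_eq {t : ℝ} (ht : 0 < t) (u : ℝ) :
    scaledPoisson t u = (2 - t) / (1 + 4 * (1 - t) * (Real.sin (t * u / 2) / t) ^ 2) := by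
  rw [scaledPoisson, angularPoisson, mul_div_assoc', div_pow]
  have : t ^ 2 + 4 * (1 - t) * Real.sin (t * u / 2) ^ 2 =
      t ^ 2 * (1 + 4 * (1 - t) * (Real.sin (t * u / 2) ^ 2 / t ^ 2)) := by field_simp
  rw [this, show t * (t * (2 - t)) = t ^ 2 * (2 - t) by ring]
  exact mul_div_mul_left _ _ (by positivity)

theorem tendsto_scaledPoisson (u : ℝ) :
    Tendsto (fun t => scaledPoisson t u) (𝓝[>] 0) (𝓝 (2 / (1 + u ^ 2))) := by
  have hsin : Tendsto (fun t : ℝ => Real.sin (t * u / 2) / t) (𝓝[>] 0) (𝓝 (u / 2)) := by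
    have h : HasDerivAt (fun t : ℝ => Real.sin (t * u / 2)) (u / 2) 0 := by
      have h1 : HasDerivAt (fun t : ℝ => t * u / 2) (u / 2) 0 := by
        simpa using ((hasDerivAt_id (0 : ℝ)).mul_const u).div_const 2
      simpa using h1.sin
    have h2 := h.tendsto_slope_zero_right
    refine h2.congr fun t => ?_
    simp [div_eq_inv_mul]
  have ht : Tendsto (fun t : ℝ => t) (𝓝[>] 0) (𝓝 0) := nhdsWithin_le_nhds
  have h1 : Tendsto (fun t : ℝ => (2 - t) / (1 + 4 * (1 - t) * (Real.sin (t * u / 2) / t) ^ 2))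
      (𝓝[>] 0) (𝓝 ((2 - 0) / (1 + 4 * (1 - 0) * (u / 2) ^ 2))) := by
    refine (tendsto_const_nhds.sub ht).div (tendsto_const_nhds.add
      ((tendsto_const_nhds.mul (tendsto_const_nhds.sub ht)).mul (hsin.pow 2))) (by positivity)
  rw [show (2 - 0 : ℝ) / (1 + 4 * (1 - 0) * (u / 2) ^ 2) = 2 / (1 + u ^ 2) by
    rw [sub_zero, sub_zero]; congr 1; ring] at h1
  refine h1.congr' ?_
  filter_upwards [self_mem_nhdsWithin] with t ht
  rw [scaledPoisson_eq ht]

/-- Jordan's inequality and `π² ≤ 10` give `(sin (tu/2) / t)² ≥ u²/10`; since `4 (1 - t) ≥ 2`, the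
kernel is at most `2 / (1 + u²/5)`. -/
theorem scaledPoisson_le {t u : ℝ} (ht : 0 < t) (ht' : t ≤ 1 / 2) (hu : |t * u| ≤ Real.pi) :
    scaledPoisson t u ≤ 10 * (1 + u ^ 2)⁻¹ := by
  have hpi := Real.pi_pos
  have h1 : |t * u / 2| ≤ Real.pi / 2 := by rw [abs_div, abs_two]; linarith
  have h2 := Real.mul_abs_le_abs_sin h1
  have h3 : (2 / Real.pi * |t * u / 2|) ^ 2 ≤ Real.sin (t * u / 2) ^ 2 := by
    rw [← sq_abs (Real.sin _)]
    gcongr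
  have h4 : 1 / 10 * u ^ 2 ≤ (Real.sin (t * u / 2) / t) ^ 2 := by
    rw [div_pow, le_div_iff₀ (by positivity)]
    refine le_trans ?_ h3
    rw [mul_pow, sq_abs, div_pow, div_pow, mul_pow]
    have h5 : Real.pi ^ 2 ≤ 10 := by nlinarith [Real.pi_lt_d2]
    have h6 : (1 : ℝ) / 10 ≤ 1 / Real.pi ^ 2 := one_div_le_one_div_of_le (by positivity) h5
    calc 1 / 10 * u ^ 2 * t ^ 2 ≤ 1 / Real.pi ^ 2 * u ^ 2 * t ^ 2 := by gcongr
      _ = _ := by field_simp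
  rw [scaledPoisson_eq ht, ← div_eq_mul_inv]
  rw [div_le_div_iff₀ (by nlinarith [sq_nonneg (Real.sin (t * u / 2) / t)]) (by positivity)]
  nlinarith [sq_nonneg (Real.sin (t * u / 2) / t), sq_nonneg u]

/-- The rescaled integrand of the polyspherical function. -/
noncomputable def scaledIntegrand (w : ℂ) (n : ℕ) (t u : ℝ) : ℂ :=
  (Icc (-(Real.pi / t)) (Real.pi / t)).indicator (fun u =>
    ((1 + Real.log (scaledPoisson t u) / Real.log t⁻¹ : ℝ) : ℂ) ^ n *
      (scaledPoisson t u : ℂ) ^ w) u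

theorem tendsto_log_inv : Tendsto (fun t : ℝ => Real.log t⁻¹) (𝓝[>] 0) atTop :=
  Real.tendsto_log_atTop.comp tendsto_inv_nhdsGT_zero

theorem tendsto_scaledIntegrand (w : ℂ) (n : ℕ) (u : ℝ) :
    Tendsto (fun t => scaledIntegrand w n t u) (𝓝[>] 0)
      (𝓝 (((2 / (1 + u ^ 2) : ℝ) : ℂ) ^ w)) := by
  have hQ := tendsto_scaledPoisson u
  have hpos : 0 < 2 / (1 + u ^ 2) := by positivity
  have h1 : Tendsto (fun t => (1 + Real.log (scaledPoisson t u) / Real.log t⁻¹ : ℝ)) (𝓝[>] 0)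
      (𝓝 1) := by
    have := (hQ.log hpos.ne').mul (tendsto_inv_atTop_zero.comp tendsto_log_inv)
    simpa [div_eq_mul_inv] using this.const_add 1
  have h2 : Tendsto (fun t => (scaledPoisson t u : ℂ) ^ w) (𝓝[>] 0)
      (𝓝 (((2 / (1 + u ^ 2) : ℝ) : ℂ) ^ w)) :=
    (Complex.continuous_ofReal.tendsto _ |>.comp hQ).cpow tendsto_const_nhds
      (Complex.ofReal_mem_slitPlane.2 hpos)
  have h3 := ((Complex.continuous_ofReal.tendsto _ |>.comp h1).pow n).mul h2
  simp only [Complex.ofReal_one, one_pow, one_mul] at h3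
  refine h3.congr' ?_
  have hpi := Real.pi_pos
  have hδ : 0 < Real.pi / (|u| + 1) := by positivity
  filter_upwards [Ioc_mem_nhdsGT hδ] with t ht
  have ht0 : 0 < t := ht.1
  have h4 : |u| ≤ Real.pi / t := by
    have := ht.2
    rw [le_div_iff₀ (by positivity)] at this
    rw [le_div_iff₀ ht0]
    nlinarith
  rw [scaledIntegrand, indicator_of_mem (by exact abs_le.1 h4)]
  rfl

/-- The dominating function: the base of the `n`-th power is `log P / log t⁻¹` for the unscaled
kernel `P`, hence at most `2` in absolute value, uniformly in `t`. -/
theorem norm_scaledIntegrand_le (w : ℂ) (hw : 0 ≤ w.re) (n : ℕ) {t : ℝ} (ht : 0 < t)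
    (ht' : t ≤ 1 / 4) (u : ℝ) :
    ‖scaledIntegrand w n t u‖ ≤ 2 ^ n * ((10 : ℝ) ^ w.re * (1 + ‖u‖ ^ 2) ^ (-(2 * w.re) / 2)) := by
  have hpi := Real.pi_pos
  by_cases hu : u ∈ Icc (-(Real.pi / t)) (Real.pi / t)
  · rw [scaledIntegrand, indicator_of_mem hu]
    have hu2 : |t * u| ≤ Real.pi := by
      rw [abs_mul, abs_of_pos ht]
      have := abs_le.2 hu
      rw [le_div_iff₀ ht] at this
      linarith
    have hq : 0 < angularPoisson t (t * u) := angularPoisson_pos ht (by linarith)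
    have hQ : 0 < scaledPoisson t u := mul_pos ht hq
    have hL : 0 < Real.log t⁻¹ := Real.log_pos (by rw [one_lt_inv₀ ht]; linarith)
    obtain ⟨b1, b2⟩ := angularPoisson_bounds ht (by linarith) (t * u)
    have hlog := abs_log_le_of_le_of_le ht ht' b1 b2
    have e1 : (1 + Real.log (scaledPoisson t u) / Real.log t⁻¹ : ℝ) =
        Real.log (angularPoisson t (t * u)) / Real.log t⁻¹ := by
      rw [scaledPoisson, Real.log_mul ht.ne' hq.ne']
      have : Real.log t = -Real.log t⁻¹ := by simp
      rw [this, add_div, neg_div, div_self hL.ne']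
      ring
    rw [norm_mul, norm_pow, Complex.norm_real, e1, Complex.norm_cpow_eq_rpow_re_of_pos hQ,
      Real.norm_eq_abs, abs_div, abs_of_pos hL]
    have e2 : |Real.log (angularPoisson t (t * u))| / Real.log t⁻¹ ≤ 2 := by
      rwa [div_le_iff₀ hL]
    have e3 : scaledPoisson t u ^ w.re ≤ 10 ^ w.re * (1 + ‖u‖ ^ 2) ^ (-(2 * w.re) / 2) := by
      calc _ ≤ (10 * (1 + u ^ 2)⁻¹) ^ w.re := by
            gcongr
            exact scaledPoisson_le ht (by linarith) hu2
        _ = _ := by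
            rw [Real.mul_rpow (by norm_num) (by positivity), Real.norm_eq_abs, sq_abs,
              show -(2 * w.re) / 2 = -w.re by ring, Real.rpow_neg (by positivity),
              Real.inv_rpow (by positivity)]
    gcongr
  · rw [scaledIntegrand, indicator_of_notMem hu, norm_zero]
    positivity

theorem tendsto_integral_scaledIntegrand {w : ℂ} (hw : 1 / 2 < w.re) (n : ℕ) :
    Tendsto (fun t => ∫ u, scaledIntegrand w n t u) (𝓝[>] 0)
      (𝓝 (∫ u : ℝ, ((2 / (1 + u ^ 2) : ℝ) : ℂ) ^ w)) := by
  refine tendsto_integral_filter_of_dominated_convergence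
    (fun u => 2 ^ n * ((10 : ℝ) ^ w.re * (1 + ‖u‖ ^ 2) ^ (-(2 * w.re) / 2))) ?_ ?_ ?_ ?_
  · filter_upwards [Ioc_mem_nhdsGT (show (0 : ℝ) < 1 / 4 by norm_num)] with t ht
    have hQc : Continuous (scaledPoisson t) :=
      continuous_const.mul ((continuous_angularPoisson ht.1 (by linarith [ht.2])).comp
        (continuous_const.mul continuous_id))
    have hQ (u : ℝ) : 0 < scaledPoisson t u :=
      mul_pos ht.1 (angularPoisson_pos ht.1 (by linarith [ht.2]))
    refine (Continuous.aestronglyMeasurable ?_).indicator measurableSet_Icc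
    refine ((Complex.continuous_ofReal.comp (continuous_const.add
      ((hQc.log fun u => (hQ u).ne').div_const _))).pow n).mul ?_
    exact (Complex.continuous_ofReal.comp hQc).cpow continuous_const
      fun u => Complex.ofReal_mem_slitPlane.2 (hQ u)
  · filter_upwards [Ioc_mem_nhdsGT (show (0 : ℝ) < 1 / 4 by norm_num)] with t ht
    exact Eventually.of_forall (norm_scaledIntegrand_le w (by linarith) n ht.1 ht.2)
  · refine ((integrable_rpow_neg_one_add_norm_sq ?_).const_mul _).const_mul _
    simp only [Module.finrank_self, Nat.cast_one]
    linarith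
  · exact Eventually.of_forall (tendsto_scaledIntegrand w n)

/-- Substitute `θ = t u`. As `log P = log t⁻¹ * (1 + log (t P) / log t⁻¹)`, the powers of `t` and of
`log t⁻¹` factor out and leave an integral with a finite limit. -/
theorem norm_polyspherical_eq {lam : ℂ} (hlam : lam ≠ -1 / 4) (n : ℕ) {z : ℂ} (hz : ‖z‖ < 1)
    (hz' : 1 - ‖z‖ ≤ 1 / 4) :
    ‖polyspherical lam n z‖ = 1 / (2 * Real.pi) *
      ‖1 / ((n.factorial : ℂ) * (2 * rootParam lam) ^ n)‖ *
      (1 - ‖z‖) ^ (1 / 2 - (rootParam lam).re) * Real.log (1 - ‖z‖)⁻¹ ^ n *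
      ‖∫ u, scaledIntegrand (rootParam lam + 1 / 2) n (1 - ‖z‖) u‖ := by
  have hpi := Real.pi_pos
  set t := 1 - ‖z‖
  have ht : 0 < t := by simp only [t]; linarith
  have hL : 0 < Real.log t⁻¹ := Real.log_pos (by rw [one_lt_inv₀ ht]; linarith)
  set s := rootParam lam
  set A : ℂ := 1 / ((n.factorial : ℂ) * (2 * s) ^ n)
  have hprof (u : ℝ) : polyProfile lam n (angularPoisson t (t * u)) =
      A * (Real.log t⁻¹ : ℂ) ^ n * (t : ℂ) ^ (-(s + 1 / 2)) *
        (((1 + Real.log (scaledPoisson t u) / Real.log t⁻¹ : ℝ) : ℂ) ^ n *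
          (scaledPoisson t u : ℂ) ^ (s + 1 / 2)) := by
    have hq : 0 < angularPoisson t (t * u) := angularPoisson_pos ht (by linarith)
    have hQ : 0 < scaledPoisson t u := mul_pos ht hq
    have e1 : Real.log (angularPoisson t (t * u)) =
        Real.log t⁻¹ * (1 + Real.log (scaledPoisson t u) / Real.log t⁻¹) := by
      rw [scaledPoisson, Real.log_mul ht.ne' hq.ne', mul_add, mul_div_cancel₀ _ hL.ne',
        Real.log_inv]
      ring
    have e2 : (angularPoisson t (t * u) : ℂ) ^ (s + 1 / 2) =
        (t : ℂ) ^ (-(s + 1 / 2)) * (scaledPoisson t u : ℂ) ^ (s + 1 / 2) := by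
      rw [ofReal_cpow_eq_exp hq, ofReal_cpow_eq_exp ht, ofReal_cpow_eq_exp hQ, ← Complex.exp_add,
        scaledPoisson, Real.log_mul ht.ne' hq.ne']
      congr 1
      push_cast
      ring
    rw [polyProfile, if_neg hlam, e2, Complex.ofReal_neg, neg_neg, e1, Complex.ofReal_mul, mul_pow]
    ring
  have hint : ∫ θ in (-Real.pi)..Real.pi, polyProfile lam n (angularPoisson t θ) =
      (t : ℂ) * (A * (Real.log t⁻¹ : ℂ) ^ n * (t : ℂ) ^ (-(s + 1 / 2)) *
        ∫ u, scaledIntegrand (s + 1 / 2) n t u) := by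
    have h := intervalIntegral.smul_integral_comp_mul_left
      (fun θ => polyProfile lam n (angularPoisson t θ)) t
      (a := -(Real.pi / t)) (b := Real.pi / t)
    rw [mul_neg, mul_div_cancel₀ _ ht.ne'] at h
    rw [← h, Complex.real_smul]
    congr 1
    simp only [hprof]
    rw [intervalIntegral.integral_const_mul]
    congr 1
    have hle : -(Real.pi / t) ≤ Real.pi / t := by
      have : 0 < Real.pi / t := by positivity
      linarith
    rw [intervalIntegral.integral_of_le hle, ← integral_Icc_eq_integral_Ioc,
      ← integral_indicator measurableSet_Icc]
    rfl
  rw [polyspherical_eq hz, hint]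
  simp only [norm_mul, norm_pow, Complex.norm_real, Real.norm_eq_abs]
  rw [abs_of_pos ht, abs_of_pos hL, abs_of_pos (by positivity : 0 < 1 / (2 * Real.pi)),
    Complex.norm_cpow_eq_rpow_re_of_pos ht]
  have e : t ^ (1 / 2 - s.re) = t * t ^ (-(s + 1 / 2)).re := by
    have : (-(s + 1 / 2)).re = -(s.re + 1 / 2) := by
      simp only [Complex.neg_re, Complex.add_re, Complex.div_ofNat_re, Complex.one_re]
    rw [this, show 1 / 2 - s.re = 1 + -(s.re + 1 / 2) by ring, Real.rpow_add ht, Real.rpow_one]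
  rw [e]
  ring

/-- The principal root halves the argument, which lies strictly between `-π` and `π` off the cut. -/
theorem rootParam_re_pos {lam : ℂ} (hlam : ∀ x : ℝ, x < -1 / 4 → lam ≠ (x : ℂ))
    (hne : lam ≠ -1 / 4) : 0 < (rootParam lam).re := by
  have h0 : lam + 1 / 4 ≠ 0 := fun h => hne (by linear_combination h)
  have harg : Complex.arg (lam + 1 / 4) ≠ Real.pi := by
    intro h
    rw [Complex.arg_eq_pi_iff] at h
    refine hlam lam.re ?_ ?_
    · have := h.1
      simp only [Complex.add_re, Complex.div_ofNat_re, Complex.one_re] at this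
      linarith
    · apply Complex.ext
      · simp
      · have := h.2
        simpa using this
  rw [rootParam, Complex.cpow_def_of_ne_zero h0, Complex.exp_re]
  refine mul_pos (Real.exp_pos _) (Real.cos_pos_of_mem_Ioo ?_)
  have h1 := Complex.neg_pi_lt_arg (lam + 1 / 4)
  have h2 := lt_of_le_of_ne (Complex.arg_le_pi (lam + 1 / 4)) harg
  have : (Complex.log (lam + 1 / 4) * (1 / 2)).im = Complex.arg (lam + 1 / 4) / 2 := by
    simp [Complex.mul_im, Complex.log_im]
    ring
  rw [this]
  constructor <;> linarith

theorem le_norm_polyspherical {lam : ℂ} (hs : 0 < (rootParam lam).re) (hlam : lam ≠ -1 / 4)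
    (n : ℕ) :
    ∃ c > 0, ∀ᶠ t in 𝓝[>] (0 : ℝ), ∀ z : ℂ, 1 - ‖z‖ = t →
      c * t ^ (1 / 2 - (rootParam lam).re) * Real.log t⁻¹ ^ n ≤ ‖polyspherical lam n z‖ := by
  have hw : 1 / 2 < (rootParam lam + 1 / 2).re := by
    simp only [Complex.add_re, Complex.div_ofNat_re, Complex.one_re]
    linarith
  have hlim := (tendsto_integral_scaledIntegrand hw n).norm
  have hne := norm_pos_iff.2 (integral_two_div_one_add_sq_cpow_ne_zero hw)
  have hpi := Real.pi_pos
  have hs0 : rootParam lam ≠ 0 := fun h => by simp [h] at hs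
  have hA : 0 < ‖1 / ((n.factorial : ℂ) * (2 * rootParam lam) ^ n)‖ := by
    rw [norm_pos_iff]
    have : (n.factorial : ℂ) ≠ 0 := by exact_mod_cast n.factorial_ne_zero
    exact div_ne_zero one_ne_zero (mul_ne_zero this (pow_ne_zero _ (mul_ne_zero two_ne_zero hs0)))
  refine ⟨1 / (2 * Real.pi) * ‖1 / ((n.factorial : ℂ) * (2 * rootParam lam) ^ n)‖ *
    (‖∫ u : ℝ, ((2 / (1 + u ^ 2) : ℝ) : ℂ) ^ (rootParam lam + 1 / 2)‖ / 2), by positivity, ?_⟩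
  filter_upwards [Ioc_mem_nhdsGT (show (0 : ℝ) < 1 / 4 by norm_num),
    hlim.eventually_const_le (half_lt_self hne)] with t ht hI z hz
  have ht0 : 0 < t := ht.1
  have hL : 0 < Real.log t⁻¹ := Real.log_pos (by rw [one_lt_inv₀ ht0]; linarith [ht.2])
  rw [norm_polyspherical_eq hlam n (by linarith) (by linarith [ht.2]), hz]
  calc _ = 1 / (2 * Real.pi) * ‖1 / ((n.factorial : ℂ) * (2 * rootParam lam) ^ n)‖ *
      t ^ (1 / 2 - (rootParam lam).re) * Real.log t⁻¹ ^ n *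
      (‖∫ u : ℝ, ((2 / (1 + u ^ 2) : ℝ) : ℂ) ^ (rootParam lam + 1 / 2)‖ / 2) := by ring
    _ ≤ _ := by gcongr

/-! ### Fatou theorem from kernel bounds -/

theorem enorm_div_le_mul_lintegral {X Φ : ℂ} {a : ℝ} (hΦ : Φ ≠ 0) (ha : 0 ≤ a)
    {K : Boundary → ℂ} {w : Boundary → ℝ} {τ : Measure Boundary}
    (h : ‖X‖ₑ ≤ ∫⁻ y, ‖K y‖ₑ ∂τ) (hK : ∀ y, ‖K y‖ ≤ a * w y * ‖Φ‖) :
    ‖X / Φ‖ₑ ≤ ENNReal.ofReal a * ∫⁻ y, ENNReal.ofReal (w y) ∂τ := by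
  have h1 : ‖X‖ₑ ≤ ENNReal.ofReal a * (∫⁻ y, ENNReal.ofReal (w y) ∂τ) * ‖Φ‖ₑ := by
    rw [← lintegral_const_mul' _ _ ENNReal.ofReal_ne_top, ← lintegral_mul_const' _ _ enorm_ne_top]
    refine h.trans (lintegral_mono fun y => ?_)
    rw [← ofReal_norm (K y), ← ofReal_norm Φ, ← ENNReal.ofReal_mul ha,
      ← ENNReal.ofReal_mul' (norm_nonneg _)]
    exact ENNReal.ofReal_le_ofReal (hK y)
  have h2 : ‖X / Φ‖ₑ * ‖Φ‖ₑ = ‖X‖ₑ := by rw [← enorm_mul, div_mul_cancel₀ _ hΦ]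
  rw [← h2] at h1
  exact (ENNReal.mul_le_mul_iff_left (enorm_ne_zero.2 hΦ) enorm_ne_top).1 h1

theorem polyKernel_bounded (lam : ℂ) (n : ℕ) {z : ℂ} (hz : ‖z‖ < 1) :
    ∃ M, ∀ y, ‖polyKernel lam n z y‖ ≤ M := by
  obtain ⟨M, hM⟩ := isCompact_univ.exists_bound_of_continuousOn
    (continuous_polyKernel lam n hz).continuousOn
  exact ⟨M, fun y => hM y (mem_univ y)⟩

/-- Here `Λ` is the gain between consecutive orders: the `k`-th kernel over `Φ_n` is bounded by
`Λ^(k-n) W`. Linear growth keeps the `W`-integral bounded, so the orders `k < n` vanish. For `k = n`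
the powers cancel, and sublinear growth of the deviation gives the limit. -/
theorem tendsto_div_polyspherical {lam : ℂ} {n : ℕ} {f : ℂ → ℂ}
    {μ : Fin (n + 1) → ComplexMeasure Boundary}
    (hf : ∀ z : ℂ, ‖z‖ < 1 → f z = ∑ k : Fin (n + 1),
      VectorMeasure.integral (μ k) (polyKernel lam k z) (ContinuousLinearMap.mul ℝ ℂ))
    {l : Filter ℂ} {R Λ : ℂ → ℝ} {W : ℝ → ℝ → ℝ} {ξ : Boundary} (hW : LocalKernel W)
    (hl : ∀ᶠ z in l, ‖z‖ < 1) (hR : Tendsto R l (𝓝[>] 0)) (hΛ : Tendsto Λ l atTop)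
    (hΦ : ∀ᶠ z in l, polyspherical lam n z ≠ 0)
    (hK : ∀ k : ℕ, ∃ C : ℝ, 0 ≤ C ∧ ∀ᶠ z in l, ∀ y, ‖polyKernel lam k z y‖ * Λ z ^ n ≤
      C * Λ z ^ k * W (R z) (dist y ξ) * ‖polyspherical lam n z‖)
    (hμ : ∀ k, LinearGrowth (μ k).variation ξ)
    (htop : SublinearGrowth (deviation (μ (Fin.last n)) arcMeasure ξ) ξ) :
    Tendsto (fun z => f z / polyspherical lam n z) l
      (𝓝 ((μ (Fin.last n)).rnDeriv arcMeasure ξ)) := by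
  set g := (μ (Fin.last n)).rnDeriv arcMeasure ξ
  set I : Fin (n + 1) → ℂ → ℂ := fun k z =>
    VectorMeasure.integral (μ k) (polyKernel lam k z) (ContinuousLinearMap.mul ℝ ℂ)
  have hK' (k : ℕ) : ∃ C : ℝ, 0 ≤ C ∧ ∀ᶠ z in l, ∀ y, ‖polyKernel lam k z y‖ ≤
      C * Λ z ^ k / Λ z ^ n * W (R z) (dist y ξ) * ‖polyspherical lam n z‖ := by
    obtain ⟨C, hC, h⟩ := hK k
    refine ⟨C, hC, ?_⟩
    filter_upwards [h, hΛ.eventually_gt_atTop 0] with z hz hz0 y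
    have h1 : 0 < Λ z ^ n := by positivity
    rw [div_mul_eq_mul_div, div_mul_eq_mul_div, le_div_iff₀ h1]
    exact hz y
  have hmain : Tendsto (fun z => (I (Fin.last n) z - polyspherical lam n z * g) /
      polyspherical lam n z) l (𝓝 0) := by
    rw [tendsto_zero_iff_enorm_tendsto_zero]
    obtain ⟨C, hC, h⟩ := hK' n
    have h0 : Tendsto (fun z => ENNReal.ofReal C * ∫⁻ y, ENNReal.ofReal (W (R z) (dist y ξ))
        ∂(deviation (μ (Fin.last n)) arcMeasure ξ)) l (𝓝 (ENNReal.ofReal C * 0)) :=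
      ENNReal.Tendsto.const_mul ((hW.tendsto htop).comp hR) (Or.inr ENNReal.ofReal_ne_top)
    rw [mul_zero] at h0
    refine tendsto_of_tendsto_of_tendsto_of_le_of_le' tendsto_const_nhds h0
      (Eventually.of_forall fun _ => zero_le) ?_
    filter_upwards [h, hl, hΦ, hΛ.eventually_gt_atTop 0] with z hz hz1 hz2 hz3
    obtain ⟨M, hM⟩ := polyKernel_bounded lam n hz1
    refine enorm_div_le_mul_lintegral hz2 hC (enorm_vectorIntegral_sub_le _ _ _
      (continuous_polyKernel lam n hz1).measurable hM) fun y => ?_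
    have := hz y
    rwa [mul_div_cancel_right₀ _ (by positivity)] at this
  have hlow (k : Fin n) : Tendsto (fun z => I k.castSucc z / polyspherical lam n z) l (𝓝 0) := by
    rw [tendsto_zero_iff_enorm_tendsto_zero]
    obtain ⟨C, hC, h⟩ := hK' k
    obtain ⟨B, hB⟩ := hW.eventually_le (hμ k.castSucc)
    have hk : Tendsto (fun z => C * Λ z ^ (k : ℕ) / Λ z ^ n) l (𝓝 0) := by
      have h1 := (tendsto_pow_div_pow_atTop_zero (𝕜 := ℝ) k.isLt).comp hΛ
      have h2 := h1.const_mul C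
      rw [mul_zero] at h2
      refine h2.congr fun z => ?_
      simp only [Function.comp_apply, mul_div_assoc]
    have h0 : Tendsto (fun z => ENNReal.ofReal (C * Λ z ^ (k : ℕ) / Λ z ^ n) * ENNReal.ofReal B)
        l (𝓝 (ENNReal.ofReal 0 * ENNReal.ofReal B)) :=
      ENNReal.Tendsto.mul_const (ENNReal.tendsto_ofReal hk) (Or.inr ENNReal.ofReal_ne_top)
    rw [ENNReal.ofReal_zero, zero_mul] at h0
    refine tendsto_of_tendsto_of_tendsto_of_le_of_le' tendsto_const_nhds h0
      (Eventually.of_forall fun _ => zero_le) ?_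
    filter_upwards [h, hΦ, hR.eventually hB, hΛ.eventually_gt_atTop 0] with z hz hz2 hzB hz3
    refine (enorm_div_le_mul_lintegral hz2 (by positivity) (enorm_vectorIntegral_le _ _) hz).trans ?_
    gcongr
  have hsum := (tendsto_finsetSum Finset.univ fun k _ => hlow k).add (hmain.add_const g)
  simp only [Finset.sum_const_zero, zero_add] at hsum
  refine hsum.congr' ?_
  filter_upwards [hl, hΦ] with z hz hz2
  rw [hf z hz, Fin.sum_univ_castSucc, add_div, Finset.sum_div]
  congr 1
  rw [sub_div, mul_div_cancel_left₀ _ hz2, sub_add_cancel]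

/-! ### Upper bounds for the polyharmonic kernels -/

theorem abs_log_poissonKernel_le {z : ℂ} (hz : ‖z‖ < 1) (hz' : 1 - ‖z‖ ≤ 1 / 4) (y : Boundary) :
    |Real.log (poissonKernel z y)| ≤ 2 * Real.log (1 - ‖z‖)⁻¹ :=
  abs_log_le_of_le_of_le (by linarith) hz' (poissonKernel_bounds hz y).1 (poissonKernel_bounds hz y).2

theorem one_sub_norm_le_norm_sub (z : ℂ) (y : Boundary) : 1 - ‖z‖ ≤ ‖(y : ℂ) - z‖ := by
  have hy : ‖(y : ℂ)‖ = 1 := by simp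
  have := norm_sub_norm_le (y : ℂ) z
  rwa [hy] at this

theorem poissonKernel_le {z : ℂ} (hz : ‖z‖ < 1) (y : Boundary) :
    poissonKernel z y ≤ 2 * (1 - ‖z‖) * (‖(y : ℂ) - z‖⁻¹) ^ 2 := by
  rw [poissonKernel, div_eq_mul_inv, inv_pow]
  gcongr
  nlinarith [norm_nonneg z]

theorem norm_polyKernel_le {lam : ℂ} (hlam : lam ≠ -1 / 4) (k : ℕ) {z : ℂ} (hz : ‖z‖ < 1)
    (hz' : 1 - ‖z‖ ≤ 1 / 4) (y : Boundary) :
    ‖polyKernel lam k z y‖ ≤ ‖1 / ((k.factorial : ℂ) * (2 * rootParam lam) ^ k)‖ *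
      (2 * Real.log (1 - ‖z‖)⁻¹) ^ k * poissonKernel z y ^ ((rootParam lam).re + 1 / 2) := by
  have hp := poissonKernel_pos hz y
  have hre : (rootParam lam + 1 / 2).re = (rootParam lam).re + 1 / 2 := by
    simp only [Complex.add_re, Complex.div_ofNat_re, Complex.one_re]
  rw [polyKernel_eq_polyProfile, polyProfile, if_neg hlam, norm_mul, norm_mul, norm_pow, norm_neg,
    Complex.norm_real, Real.norm_eq_abs, abs_neg, Complex.norm_cpow_eq_rpow_re_of_pos hp, hre]
  gcongr
  exact abs_log_poissonKernel_le hz hz' y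

theorem norm_polyKernel_bottom_le (k : ℕ) {z : ℂ} (hz : ‖z‖ < 1) (hz' : 1 - ‖z‖ ≤ 1 / 4)
    (y : Boundary) :
    ‖polyKernel (-1 / 4) k z y‖ ≤
      (2 * Real.log (1 - ‖z‖)⁻¹) ^ (2 * k) * poissonKernel z y ^ (1 / 2 : ℝ) := by
  have hp := poissonKernel_pos hz y
  rw [polyKernel_eq_polyProfile, polyProfile_bottom hp, Complex.norm_real, Real.norm_eq_abs,
    abs_mul, abs_mul, abs_pow, abs_of_nonneg (by positivity : 0 ≤ poissonKernel z y ^ (1 / 2 : ℝ))]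
  have h1 : |1 / ((2 * k).factorial : ℝ)| ≤ 1 := by
    rw [abs_of_nonneg (by positivity)]
    exact div_le_one_of_le₀ (by exact_mod_cast Nat.one_le_iff_ne_zero.2 (Nat.factorial_ne_zero _))
      (by positivity)
  have h2 := abs_log_poissonKernel_le hz hz' y
  calc _ ≤ 1 * (2 * Real.log (1 - ‖z‖)⁻¹) ^ (2 * k) * poissonKernel z y ^ (1 / 2 : ℝ) := by gcongr
    _ = _ := by rw [one_mul]

/-- Here `q = |y - z|` and `d = |y - ξ|`. Admissibility enters only through `hmax`, which replaces
`q` by `m = max t d`. Then `(t / m²)^(σ + 1/2)` splits into the radial kernel and the factor `t^(1/2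
- σ)` of `Φ`. -/
theorem norm_polyKernel_mul_le {σ c t d q P A L x Φ C : ℝ} (k n : ℕ) (hσ : 0 < σ) (hc : 0 < c)
    (ht : 0 < t) (hC : 0 ≤ C) (hq : 0 < q) (hP : 0 < P) (hA : 0 ≤ A) (hL : 0 < L)
    (hPq : P ≤ 2 * t * q⁻¹ ^ 2) (hmax : max t d ≤ (1 + C) * q)
    (hx : x ≤ A * (2 * L) ^ k * P ^ (σ + 1 / 2)) (hΦ : c * t ^ (1 / 2 - σ) * L ^ n ≤ Φ) :
    x * L ^ n ≤ A * 2 ^ k * (2 * (1 + C) ^ 2) ^ (σ + 1 / 2) / c * L ^ k *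
      (t ^ (2 * σ) * max t d ^ (-(1 + 2 * σ))) * Φ := by
  set m := max t d
  have hm : 0 < m := lt_max_of_lt_left ht
  have hPm : P ≤ 2 * (1 + C) ^ 2 * (t * m⁻¹ ^ 2) := by
    have h1 : q⁻¹ ≤ (1 + C) * m⁻¹ := by
      rw [← div_eq_mul_inv, inv_le_comm₀ hq (by positivity), inv_div, div_le_iff₀ (by positivity)]
      linarith
    calc P ≤ 2 * t * ((1 + C) * m⁻¹) ^ 2 := hPq.trans (by gcongr)
      _ = _ := by ring
  have e1 : (t * m⁻¹ ^ 2) ^ (σ + 1 / 2) =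
      t ^ (2 * σ) * m ^ (-(1 + 2 * σ)) * t ^ (1 / 2 - σ) := by
    rw [Real.mul_rpow ht.le (by positivity), inv_pow, Real.inv_rpow (by positivity),
      ← Real.rpow_natCast, ← Real.rpow_mul hm.le, ← Real.rpow_neg hm.le, mul_right_comm,
      ← Real.rpow_add ht]
    congr 2
    · ring
    · push_cast
      ring
  calc x * L ^ n ≤ A * (2 * L) ^ k * (2 * (1 + C) ^ 2 * (t * m⁻¹ ^ 2)) ^ (σ + 1 / 2) * L ^ n := by
        have : P ^ (σ + 1 / 2) ≤ (2 * (1 + C) ^ 2 * (t * m⁻¹ ^ 2)) ^ (σ + 1 / 2) := by gcongr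
        have h2 : x ≤ A * (2 * L) ^ k * (2 * (1 + C) ^ 2 * (t * m⁻¹ ^ 2)) ^ (σ + 1 / 2) :=
          hx.trans (by gcongr)
        gcongr
    _ = A * 2 ^ k * (2 * (1 + C) ^ 2) ^ (σ + 1 / 2) / c * L ^ k *
      (t ^ (2 * σ) * m ^ (-(1 + 2 * σ))) * (c * t ^ (1 / 2 - σ) * L ^ n) := by
        rw [Real.mul_rpow (by positivity) (by positivity), e1, mul_pow]
        field_simp
    _ ≤ _ := by gcongr

/-- The kernel adapted to the enlarged-admissible regions. -/
noncomputable def enlargedKernel (C R d : ℝ) : ℝ :=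
  (Iic (2 * C * R)).indicator (fun _ => R⁻¹) d + (Real.log R⁻¹)⁻¹ * (max R d)⁻¹

theorem localKernel_enlargedKernel {C : ℝ} (hC : 0 < C) : LocalKernel (enlargedKernel C) :=
  (localKernel_indicator (c := 2 * C) (by positivity)).add localKernel_log
    fun _ => measurable_const.indicator measurableSet_Iic

/-- Put `R = t L`. If `d ≤ 2CR`, use `q ≥ t` and `1/t = L/R`. Otherwise `CR < d/2` forces `q ≥ d/2`,
and `log R⁻¹ ≤ L` because `L ≥ 1`. Either way one factor `L` is lost. -/
theorem inv_le_enlargedKernel {C t L d q : ℝ} (hC : 1 ≤ C) (ht : 0 < t) (hL : 1 ≤ L)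
    (htL : L = Real.log t⁻¹) (hR : t * L < 1) (hq : t ≤ q) (hd : d ≤ q + C * (t * L)) :
    q⁻¹ ≤ 2 * L * enlargedKernel C (t * L) d := by
  have hR0 : 0 < t * L := by positivity
  have hq0 : 0 < q := ht.trans_le hq
  have hlog : 0 < Real.log (t * L)⁻¹ := Real.log_pos ((one_lt_inv₀ hR0).2 hR)
  have hm : 0 < max (t * L) d := lt_max_of_lt_left hR0
  by_cases h : d ≤ 2 * C * (t * L)
  · rw [enlargedKernel, indicator_of_mem (by exact h)]
    have h1 : q⁻¹ ≤ t⁻¹ := inv_anti₀ ht hq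
    have h2 : t⁻¹ = L * (t * L)⁻¹ := by field_simp
    have h3 : 0 ≤ (Real.log (t * L)⁻¹)⁻¹ * (max (t * L) d)⁻¹ := by positivity
    have h4 : 0 ≤ (t * L)⁻¹ := by positivity
    nlinarith
  · rw [enlargedKernel, indicator_of_notMem (by exact h), zero_add]
    push Not at h
    have hd0 : 0 < d := lt_of_le_of_lt (by positivity) h
    have hmd : max (t * L) d = d := max_eq_right (by nlinarith)
    rw [hmd]
    have h1 : q⁻¹ ≤ 2 * d⁻¹ := by
      rw [← div_eq_mul_inv, inv_le_comm₀ hq0 (by positivity), inv_div]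
      linarith
    have h2 : Real.log (t * L)⁻¹ ≤ L := by
      rw [mul_inv, Real.log_mul (by positivity) (by positivity), ← htL, Real.log_inv]
      linarith [Real.log_nonneg hL]
    have h3 : 1 ≤ L * (Real.log (t * L)⁻¹)⁻¹ := by
      rwa [← div_eq_mul_inv, one_le_div hlog]
    calc q⁻¹ ≤ 2 * d⁻¹ * 1 := by rwa [mul_one]
      _ ≤ 2 * d⁻¹ * (L * (Real.log (t * L)⁻¹)⁻¹) := by gcongr
      _ = _ := by ring

/-! ### Convergence in the approach regions -/

section Convergence

variable {n : ℕ} {f : ℂ → ℂ} {μ : Fin (n + 1) → ComplexMeasure Boundary} {ξ : Boundary}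

theorem convergesAdmissibly_of_growth {lam : ℂ} (hs : 0 < (rootParam lam).re)
    (hlam : lam ≠ -1 / 4)
    (hf : ∀ z : ℂ, ‖z‖ < 1 → f z = ∑ k : Fin (n + 1),
      VectorMeasure.integral (μ k) (polyKernel lam k z) (ContinuousLinearMap.mul ℝ ℂ))
    (hμ : ∀ k, LinearGrowth (μ k).variation ξ)
    (htop : SublinearGrowth (deviation (μ (Fin.last n)) arcMeasure ξ) ξ) :
    ConvergesAdmissibly (fun z => f z / polyspherical lam n z) ξ
      ((μ (Fin.last n)).rnDeriv arcMeasure ξ) := by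
  intro a _
  have hsub : admissibleRegion a ξ ⊆ ball (0 : ℂ) 1 := fun z hz => hz.1
  have ht := tendsto_one_sub_norm hsub ξ
  obtain ⟨c, hc, hΦ⟩ := le_norm_polyspherical hs hlam n
  have hl : ∀ᶠ z in 𝓝[admissibleRegion a ξ] (ξ : ℂ), ‖z‖ < 1 := by
    filter_upwards [self_mem_nhdsWithin] with z hz
    simpa using hsub hz
  have hΦ' : ∀ᶠ z in 𝓝[admissibleRegion a ξ] (ξ : ℂ), c * (1 - ‖z‖) ^ (1 / 2 - (rootParam lam).re) *
      Real.log (1 - ‖z‖)⁻¹ ^ n ≤ ‖polyspherical lam n z‖ := by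
    filter_upwards [ht.eventually hΦ] with z hz using hz z rfl
  have hL := tendsto_log_inv.comp ht
  have ht4 := ht.eventually (Ioc_mem_nhdsGT (show (0 : ℝ) < 1 / 4 by norm_num))
  refine tendsto_div_polyspherical hf (R := fun z => 1 - ‖z‖)
    (localKernel_rpow (β := 2 * (rootParam lam).re) (by positivity)) hl ht hL ?_ ?_ hμ htop
  · filter_upwards [hΦ', hL.eventually_gt_atTop 0, hl] with z hz hz0 hz1
    have h1 : 0 < 1 - ‖z‖ := by linarith
    simp only [Function.comp_apply] at hz0
    rw [← norm_pos_iff]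
    exact lt_of_lt_of_le (by positivity) hz
  · intro k
    set C := 8 * Real.exp (a + 1)
    refine ⟨‖1 / ((k.factorial : ℂ) * (2 * rootParam lam) ^ k)‖ * 2 ^ k *
      (2 * (1 + C) ^ 2) ^ ((rootParam lam).re + 1 / 2) / c, by positivity, ?_⟩
    filter_upwards [hΦ', hL.eventually_gt_atTop 0, hl, ht4, self_mem_nhdsWithin]
      with z hz hz0 hz1 hz4 hzm y
    have h1 : 0 < 1 - ‖z‖ := by linarith
    have hq := one_sub_norm_le_norm_sub z y
    have hdz := norm_sub_le_of_distToRadius_le hz1 hzm.2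
    refine norm_polyKernel_mul_le k n hs hc h1 (by positivity) (h1.trans_le hq)
      (poissonKernel_pos hz1 y) (norm_nonneg _) hz0 (poissonKernel_le hz1 y) ?_
      (norm_polyKernel_le hlam k hz1 hz4.2 y) hz
    have hd : dist y ξ ≤ ‖(y : ℂ) - z‖ + ‖z - ξ‖ := by
      rw [Subtype.dist_eq, dist_eq_norm]
      exact norm_sub_le_norm_sub_add_norm_sub _ _ _
    have h2 : C * (1 - ‖z‖) ≤ C * ‖(y : ℂ) - z‖ := by gcongr
    have h3 : 0 ≤ C * ‖(y : ℂ) - z‖ := by positivity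
    refine max_le ?_ ?_ <;> linarith

theorem convergesEnlargedAdmissibly_of_growth
    (hf : ∀ z : ℂ, ‖z‖ < 1 → f z = ∑ k : Fin (n + 1),
      VectorMeasure.integral (μ k) (polyKernel (-1 / 4) k z) (ContinuousLinearMap.mul ℝ ℂ))
    (hμ : ∀ k, LinearGrowth (μ k).variation ξ)
    (htop : SublinearGrowth (deviation (μ (Fin.last n)) arcMeasure ξ) ξ) :
    ConvergesEnlargedAdmissibly (fun z => f z / polyspherical (-1 / 4) n z) ξ
      ((μ (Fin.last n)).rnDeriv arcMeasure ξ) := by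
  intro a ha
  have hsub : enlargedRegion a ξ ⊆ ball (0 : ℂ) 1 := fun z hz => hz.1
  have ht := tendsto_one_sub_norm hsub ξ
  obtain ⟨c, hc, hΦ⟩ := le_norm_polyspherical_bottom n
  have hl : ∀ᶠ z in 𝓝[enlargedRegion a ξ] (ξ : ℂ), ‖z‖ < 1 := by
    filter_upwards [self_mem_nhdsWithin] with z hz
    simpa using hsub hz
  have hΦ' : ∀ᶠ z in 𝓝[enlargedRegion a ξ] (ξ : ℂ), c * (1 - ‖z‖) ^ (1 / 2 : ℝ) *
      Real.log (1 - ‖z‖)⁻¹ ^ (2 * n + 1) ≤ ‖polyspherical (-1 / 4) n z‖ := by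
    filter_upwards [ht.eventually hΦ] with z hz using hz z rfl
  have hL : Tendsto (fun z : ℂ => Real.log (1 - ‖z‖)⁻¹) (𝓝[enlargedRegion a ξ] (ξ : ℂ)) atTop :=
    tendsto_log_inv.comp ht
  have ht4 := ht.eventually (Ioc_mem_nhdsGT (show (0 : ℝ) < 1 / 4 by norm_num))
  have hR : Tendsto (fun z : ℂ => (1 - ‖z‖) * Real.log (1 - ‖z‖)⁻¹)
      (𝓝[enlargedRegion a ξ] (ξ : ℂ)) (𝓝[>] 0) := by
    refine tendsto_nhdsWithin_iff.2 ⟨?_, ?_⟩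
    · have h1 := (Real.continuous_negMulLog.tendsto 0).comp (ht.mono_right nhdsWithin_le_nhds)
      rw [Real.negMulLog_zero] at h1
      refine h1.congr fun z => ?_
      rw [Function.comp_apply, Real.negMulLog, Real.log_inv]
      ring
    · filter_upwards [hL.eventually_gt_atTop 0, hl] with z hz hz1
      exact mul_pos (by linarith) hz
  set C := 16 * Real.exp (a + 1)
  have hC : 1 ≤ C := by
    have := Real.add_one_le_exp (a + 1)
    simp only [C]
    linarith
  -- At the bottom each order carries two logarithms, hence `Λ = L²`. The factor `L` lost in
  -- `inv_le_enlargedKernel` is matched by the odd power `L^(2n+1)` in the lower bound for `Φ_n`.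
  refine tendsto_div_polyspherical hf (Λ := fun z => Real.log (1 - ‖z‖)⁻¹ ^ 2)
    (localKernel_enlargedKernel (C := C) (by positivity)) hl hR
    ((tendsto_pow_atTop two_ne_zero).comp hL) ?_ ?_ hμ htop
  · filter_upwards [hΦ', hL.eventually_gt_atTop 0, hl] with z hz hz0 hz1
    have h1 : 0 < 1 - ‖z‖ := by linarith
    rw [← norm_pos_iff]
    exact lt_of_lt_of_le (by positivity) hz
  · intro k
    refine ⟨2 ^ (2 * k) * 4 / c, by positivity, ?_⟩
    filter_upwards [hΦ', hL.eventually_ge_atTop 1, hl, ht4, self_mem_nhdsWithin,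
      hR.eventually (Ioo_mem_nhdsGT one_pos)] with z hz hz0 hz1 hz4 hzm hzR y
    set t := 1 - ‖z‖
    have h1 : 0 < t := hz4.1
    have hq : t ≤ ‖(y : ℂ) - z‖ := one_sub_norm_le_norm_sub z y
    have hdz := norm_sub_le_of_mem_enlargedRegion hzm (by linarith [hz4.2])
    have hd : dist y ξ ≤ ‖(y : ℂ) - z‖ + C * (t * Real.log t⁻¹) := by
      rw [Subtype.dist_eq, dist_eq_norm]
      exact (norm_sub_le_norm_sub_add_norm_sub _ z _).trans (by gcongr)
    have hW := inv_le_enlargedKernel hC h1 hz0 rfl hzR.2 hq hd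
    set V := enlargedKernel C (t * Real.log t⁻¹) (dist y ξ)
    set L := Real.log t⁻¹
    have hL0 : 0 < L := by linarith
    have hP : poissonKernel z y ^ (1 / 2 : ℝ) ≤ 2 * t ^ (1 / 2 : ℝ) * ‖(y : ℂ) - z‖⁻¹ := by
      rw [← Real.sqrt_eq_rpow, ← Real.sqrt_eq_rpow]
      apply Real.sqrt_le_iff.2 ⟨by positivity, ?_⟩
      rw [mul_pow, mul_pow, Real.sq_sqrt h1.le]
      refine (poissonKernel_le hz1 y).trans ?_
      gcongr
      norm_num
    have hV : 0 ≤ V := by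
      have : 0 ≤ 2 * L * V := le_trans (by positivity) hW
      exact nonneg_of_mul_nonneg_right this (by positivity)
    calc ‖polyKernel (-1 / 4) k z y‖ * (L ^ 2) ^ n
        ≤ ((2 * L) ^ (2 * k) * (2 * t ^ (1 / 2 : ℝ) * (2 * L * V))) * (L ^ 2) ^ n := by
          gcongr
          refine (norm_polyKernel_bottom_le k hz1 hz4.2 y).trans ?_
          gcongr
          exact hP.trans (by gcongr)
      _ = 2 ^ (2 * k) * 4 / c * (L ^ 2) ^ k * V * (c * t ^ (1 / 2 : ℝ) * L ^ (2 * n + 1)) := by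
          rw [mul_pow, pow_succ L (2 * n), pow_mul L 2 k, pow_mul L 2 n]
          field_simp
          ring
      _ ≤ _ := by gcongr

end Convergence

theorem ConvergesEnlargedAdmissibly.convergesAdmissibly {g : ℂ → ℂ} {ξ : Boundary} {l : ℂ}
    (h : ConvergesEnlargedAdmissibly g ξ l) : ConvergesAdmissibly g ξ l := by
  intro a ha
  refine (h a ha).mono_left (nhdsWithin_le_iff.2 ?_)
  have ht := tendsto_one_sub_norm (fun z (hz : z ∈ admissibleRegion a ξ) => hz.1) ξ
  filter_upwards [self_mem_nhdsWithin, ht.eventually (Ioc_mem_nhdsGT (Real.exp_pos (-1))),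
    ht.eventually (Ioc_mem_nhdsGT one_half_pos)] with z hz h1 h2
  exact mem_enlargedRegion_of_mem_admissibleRegion hz h1.2 h2.2

theorem exists_radius_polyspherical_ne_zero {lam : ℂ}
    (hlam : ∀ x : ℝ, x < -1 / 4 → lam ≠ (x : ℂ)) (n : ℕ) :
    ∃ r : ℝ, r < 1 ∧ ∀ z : ℂ, r ≤ ‖z‖ → ‖z‖ < 1 → polyspherical lam n z ≠ 0 := by
  have key : ∀ᶠ t in 𝓝[>] (0 : ℝ), ∀ z : ℂ, 1 - ‖z‖ = t → polyspherical lam n z ≠ 0 := by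
    by_cases h : lam = -1 / 4
    · subst h
      obtain ⟨c, hc, hΦ⟩ := le_norm_polyspherical_bottom n
      filter_upwards [hΦ, tendsto_log_inv.eventually_gt_atTop 0, self_mem_nhdsWithin]
        with t h1 h2 (h3 : 0 < t) z hz
      exact norm_pos_iff.1 (lt_of_lt_of_le (by positivity) (h1 z hz))
    · obtain ⟨c, hc, hΦ⟩ := le_norm_polyspherical (rootParam_re_pos hlam h) h n
      filter_upwards [hΦ, tendsto_log_inv.eventually_gt_atTop 0, self_mem_nhdsWithin]
        with t h1 h2 (h3 : 0 < t) z hz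
      exact norm_pos_iff.1 (lt_of_lt_of_le (by positivity) (h1 z hz))
  obtain ⟨δ, hδ, h⟩ := mem_nhdsGT_iff_exists_Ioc_subset.1 key
  have hδ0 : 0 < δ := hδ
  exact ⟨1 - δ, by linarith, fun z h1 h2 => h ⟨by linarith, by linarith⟩ z rfl⟩

end HypDisk

open HypDisk
theorem mainTheorem12 (lam : ℂ) (hlam : ∀ x : ℝ, x < -1 / 4 → lam ≠ (x : ℂ)) (n : ℕ)
    (f : ℂ → ℂ) (hf : IsPolyharmonic lam (n + 1) f)
    (ν : Fin (n + 1) → AnalyticFunctional) (hν : IsBoundaryRepresentation lam f ν)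
    (hreg : ∀ k, ∃ μ : ComplexMeasure Boundary, (ν k).IsMeasure μ)
    (νtop : ComplexMeasure Boundary) (hνtop : (ν (Fin.last n)).IsMeasure νtop) :
    (∃ r : ℝ, r < 1 ∧ ∀ z : ℂ, r ≤ ‖z‖ → ‖z‖ < 1 → polyspherical lam n z ≠ 0) ∧
    (∀ᵐ ξ ∂arcMeasure,
      ConvergesAdmissibly (fun z => f z / polyspherical lam n z) ξ
        (νtop.rnDeriv arcMeasure ξ)) ∧
    (lam = -1 / 4 → ∀ᵐ ξ ∂arcMeasure,
      ConvergesEnlargedAdmissibly (fun z => f z / polyspherical lam n z) ξ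
        (νtop.rnDeriv arcMeasure ξ)) := by
  refine ⟨exists_radius_polyspherical_ne_zero hlam n, ?_⟩
  obtain ⟨μ, hμtop, hμ⟩ : ∃ μ : Fin (n + 1) → ComplexMeasure Boundary,
      μ (Fin.last n) = νtop ∧ ∀ k, (ν k).IsMeasure (μ k) := by
    choose μ hμ using hreg
    -- The chosen top measure is replaced by the given `νtop`, so uniqueness of representing
    -- measures is not needed.
    refine ⟨Function.update μ (Fin.last n) νtop, by simp, fun k => ?_⟩
    by_cases hk : k = Fin.last n
    · subst hk
      simpa using hνtop
    · simpa [hk] using hμ k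
  have hrep : ∀ z : ℂ, ‖z‖ < 1 → f z = ∑ k : Fin (n + 1),
      VectorMeasure.integral (μ k) (polyKernel lam k z) (ContinuousLinearMap.mul ℝ ℂ) := by
    intro z hz
    rw [hν z (by simpa using hz)]
    exact Finset.sum_congr rfl fun k _ => hμ k _
  subst hμtop
  have hgrowth : ∀ᵐ ξ ∂arcMeasure, (∀ k, LinearGrowth (μ k).variation ξ) ∧
      SublinearGrowth (deviation (μ (Fin.last n)) arcMeasure ξ) ξ :=
    (ae_all_iff.2 fun k => ae_linearGrowth _).and (ae_sublinearGrowth_deviation _)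
  by_cases h : lam = -1 / 4
  · subst h
    have henl := hgrowth.mono fun ξ hξ => convergesEnlargedAdmissibly_of_growth hrep hξ.1 hξ.2
    exact ⟨henl.mono fun ξ hξ => hξ.convergesAdmissibly, fun _ => henl⟩
  · exact ⟨hgrowth.mono fun ξ hξ => convergesAdmissibly_of_growth (rootParam_re_pos hlam h) h
      hrep hξ.1 hξ.2, fun h' => absurd h' h⟩
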